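/- Let $N,b,L\ge 1$ be integers. Consider a periodic chain of $L$ sites with on-site Hilbert space $\mathbb C^d$ and an on-site unitary $U$ of order $N$; put $U_g=U^g$ for $g\in\mathbb Z_N$. The exponential and dipole-exponential symmetries are $$\mathcal U_{E,g}=\bigotimes_j U_g^{\,b^{j-1}},\qquad \mathcal U_{DE,g}=\bigotimes_j U_g^{\,j\,b^{j-1}},$$ so the on-site group is $\mathbb Z_N\times\mathbb Z_N$, the element $(m,n)$ acting on site $j\ge1$ by $U_{(m,n),j}=U_m^{\,b^{j-1}}U_n^{\,jb^{j-1}}$. **Periodicity.** Both symmetries are well defined on the ring of $L$ sites (that is, $U^{f(j+L)}=U^{f(j)}$ for all $j\ge1$ and both $f(j)=b^{j-1}$ and $f(j)=jb^{j-1}$) if and only if $L\equiv0$ and $b^L\equiv1 \pmod N$. These conditions imply $\gcd(b,N)=1$; conversely, if $\gcd(b,N)=1$, then every $L=k\,\varphi(N)\,N$ with $k\in\mathbb N$ satisfies them. **Bond unitaries.** Let $A=(A^s)_{s=1}^d$ be a left-canonical injective MPS tensor of bond dimension $D\geq 1$: $\sum_s A^{s\dagger}A^s=\mathbb 1$, $\sum_sA^s\rho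 A^{s\dagger}=\rho$ for some positive definite $\rho$, and the eigenvalue $1$ of the transfer matrix $X\mapsto\sum_sA^{s\dagger}XA^s$ has a one-dimensional eigenspace while all other eigenvalues have modulus $<1$. Call $A$ *symmetric* if both symmetries are well defined on the ring of $L$ sites and, for every $k\ge1$ and every $g\in\mathbb Z_N\times\mathbb Z_N$, the state $\sum\mathrm{Tr}(A^{s_1}\cdots A^{s_{kL}})|s_1\dots s_{kL}\rangle$ is multiplied by a phase by the $k$-fold periodic extension of $\bigotimes_{j=1}^L U_{g,j}$. Write $\doteq$ for equality up to a phase. For every symmetric $A$ there are unitaries $v_j(g)$, $j\ge0$, $g\in\mathbb Z_N\times\mathbb Z_N$, with $U_{g,j}\cdot A\doteq v_{j-1}(g)^\dagger A\,v_j(g)$ for all $j\ge1$ (the phase depending on $j$ and $g$ only). For every such choice, with $v_{e,j}(g)=v_j(g,0)$ and $v_{de,j}(g)=v_j(0,g)$, one has for all $j\ge1$ $$v_{e,j}(g)\doteq v_{e,j-1}(g)^b,\qquad v_{de,j}(g)\doteq v_{de,j-1}(g)^b\,v_{e,j}(g)\doteq v_{de,j-1}(g)^b\,v_{e,j-1}(g)^b;$$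 every $v_j$ is a projective representation, $v_j(g)v_j(h)=\omega_j(g,h)v_j(g+h)$, whose class $[\omega_j]\in H^2(\mathbb Z_N\times\mathbb Z_N,U(1))$ depends neither on $j$ nor on the choice of the $v_j$. This class is called the (strong) SPT class of the MPS. **Classification.** The coboundary-invariant phase $\omega(e,f)/\omega(f,e)=e^{2\pi ik/N}$, where $e=(1,0)$ and $f=(0,1)$, gives an isomorphism $[\omega]\mapsto k$ from $H^2(\mathbb Z_N\times\mathbb Z_N,U(1))$ onto $\mathbb Z_N$. For a symmetric $A$ with SPT class labelled by $k$, $$v_{e,j}(1)\,v_{de,j}(1)\,v_{e,j}(1)^\dagger\,v_{de,j}(1)^\dagger=e^{2\pi ik/N}\,\mathbb 1\quad\text{for all } j,\qquad\text{and}\qquad k(b^2-1)\equiv0\pmod N.$$ If $L\equiv0$ and $b^L\equiv1\pmod N$, then the SPT classes that occur (over all $d$, $D$, all $U$ of order $N$ and all symmetric $A$) are exactly those with $k(b^2-1)\equiv0\pmod N$. They form a subgroup of $H^2(\mathbb Z_N\times\mathbb Z_N,U(1))$ isomorphic to $\mathbb Z_{\gcd(b^2-1,N)}$. -/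

import Mathlib

open scoped Matrix ComplexOrder

noncomputable section

namespace TiltedExp

/-! ### Second group cohomology with `U(1)` coefficients (trivial action) -/

/-- The group of 2-cocycles `ω : G × G → U(1)` of an (additively written) abelian group `G`. -/
def Z2 (G : Type*) [AddCommGroup G] : Subgroup (G → G → Circle) where
  carrier := {ω | ∀ g h l, ω g h * ω (g + h) l = ω h l * ω g (h + l)}
  one_mem' := by intro g h l; simp
  mul_mem' := by
    intro ω₁ ω₂ h₁ h₂ g h l
    have e := congrArg₂ (· * ·) (h₁ g h l) (h₂ g h l)
    simpa [mul_mul_mul_comm] using e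
  inv_mem' := by
    intro ω hω g h l
    have e := congrArg (·⁻¹) (hω g h l)
    simpa [mul_comm] using e

/-- The 2-coboundaries `(g, h) ↦ β(g) β(h) β(g + h)⁻¹`, as a subgroup of the 2-cocycles. -/
def B2 (G : Type*) [AddCommGroup G] : Subgroup (Z2 G) where
  carrier := {ω | ∃ β : G → Circle, ∀ g h, ω.1 g h = β g * β h * (β (g + h))⁻¹}
  one_mem' := ⟨fun _ => 1, by intro g h; simp⟩
  mul_mem' := by
    rintro ω₁ ω₂ ⟨β₁, h₁⟩ ⟨β₂, h₂⟩
    refine ⟨fun g => β₁ g * β₂ g, fun g h => ?_⟩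
    have e : (ω₁ * ω₂).1 g h = ω₁.1 g h * ω₂.1 g h := rfl
    rw [e, h₁ g h, h₂ g h]
    change _ = β₁ g * β₂ g * (β₁ h * β₂ h) * (β₁ (g + h) * β₂ (g + h))⁻¹
    rw [mul_inv]
    ac_rfl
  inv_mem' := by
    rintro ω ⟨β, hβ⟩
    refine ⟨fun g => (β g)⁻¹, fun g h => ?_⟩
    simp only [Subgroup.coe_inv, Pi.inv_apply, hβ g h, mul_inv]

/-- `H²(G, U(1))`. -/
abbrev H2 (G : Type*) [AddCommGroup G] : Type _ := Z2 G ⧸ B2 G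

/-- The class of a 2-cocycle `ω` on an abelian group is determined by the alternating bicharacter
`ω(g, h) / ω(h, g)`; on `ℤ_N × ℤ_N` this is the single `N`-th root of unity `e^{2πik/N}`.

If two left-canonical injective tensors generate the same ring states up to a phase, then the
mixed transfer matrix has an eigenvalue of modulus one, and Cauchy–Schwarz forces its eigenvectors
to be multiples of unitaries intertwining the tensors; these are the bond unitaries, unique up to a
phase. Uniqueness turns the relations `U^{b^{j+1}} = (U^{b^j})^b` and
`U^{(j+2)b^{j+1}} = (U^{(j+1)b^j})^b U^{b^{j+1}}` on the sites into the recursion on the bonds, so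
that the commutation phase on a bond is the `b²`-th power of that on the previous one. The two
phases are also equal, because the on-site operators commute; hence `k(b² - 1) ≡ 0`.

Conversely, if `k(b² - 1) ≡ 0`, then the order `n` of `ζ = e^{-2πibk/N}` divides `N` and `b² - 1`.
Let `χ` be the character of `ℤ_n` with `χ(1) = ζ`. The cluster-state tensor
`A^s = N^{-1/2} χ(as - bs²) |a⟩⟨s|` and the cyclic shift of the physical label realise `k`: the bond
unitaries are generated by the generalised Pauli matrices `Z^{-1} X^b` and `Z^{-1}`.
-/
def H2.mk {G : Type*} [AddCommGroup G] (ω : Z2 G) : H2 G := QuotientGroup.mk ω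

/-! ### The modulated symmetry -/

/-- The on-site group `ℤ_N × ℤ_N`: the first factor labels the exponential symmetry, the second
one the dipole-exponential symmetry. -/
abbrev G (N : ℕ) : Type := ZMod N × ZMod N

/-- Modulation function `b^(j-1)` of the exponential symmetry, at sites `j = 1, 2, …`. -/
def expMod (b j : ℕ) : ℕ := b ^ (j - 1)

/-- Modulation function `j b^(j-1)` of the dipole-exponential symmetry. -/
def dipExpMod (b j : ℕ) : ℕ := j * b ^ (j - 1)

/-- The modulated operator `⨂_j U^(f j)` is well defined on a periodic chain of length `L`:
going once around the chain reproduces the same on-site operators. -/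
def WellDefinedOnRing {d : ℕ} (U : Matrix (Fin d) (Fin d) ℂ) (f : ℕ → ℕ) (L : ℕ) : Prop :=
  ∀ j, 1 ≤ j → U ^ f (j + L) = U ^ f j

/-- On-site operator at site `j` of the element `g = (m, n)`:
the product of `U_m^(b^(j-1))` and `U_n^(j b^(j-1))`, where `U_m = U^m`. -/
def onSite {d : ℕ} (N b : ℕ) (U : Matrix (Fin d) (Fin d) ℂ) (g : G N) (j : ℕ) :
    Matrix (Fin d) (Fin d) ℂ :=
  (U ^ g.1.val) ^ expMod b j * (U ^ g.2.val) ^ dipExpMod b j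

/-- The tensor product operator `u 0 ⊗ ⋯ ⊗ u (n-1)` on a chain of `n` sites, in the basis of
spin configurations. -/
def chainOp {d n : ℕ} (u : Fin n → Matrix (Fin d) (Fin d) ℂ) :
    Matrix (Fin n → Fin d) (Fin n → Fin d) ℂ :=
  fun σ τ => ∏ i, u i (σ i) (τ i)

/-- The symmetry operator of `g` on a chain of `k * L` sites: the `k`-fold periodic extension of
the operator on `L` sites (position `i` in `Fin (k * L)` is site `i % L + 1` of its cell). -/
def symOp {d : ℕ} (N b L k : ℕ) (U : Matrix (Fin d) (Fin d) ℂ) (g : G N) :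
    Matrix (Fin (k * L) → Fin d) (Fin (k * L) → Fin d) ℂ :=
  chainOp fun i => onSite N b U g (i.val % L + 1)

/-! ### Matrix product states -/

/-- The translation invariant MPS on a periodic chain of `n` sites:
`ψ(s₁, …, s_n) = Tr(A^{s₁} ⋯ A^{s_n})`. -/
def mpsState {d D : ℕ} (A : Fin d → Matrix (Fin D) (Fin D) ℂ) (n : ℕ) :
    (Fin n → Fin d) → ℂ :=
  fun σ => ((List.ofFn fun i => A (σ i)).prod).trace

/-- The transfer matrix, as a map on bond matrices. -/
def transfer {d D : ℕ} (A : Fin d → Matrix (Fin D) (Fin D) ℂ) (X : Matrix (Fin D) (Fin D) ℂ) :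
    Matrix (Fin D) (Fin D) ℂ :=
  ∑ s, (A s)ᴴ * X * A s

/-- Injective MPS tensors in left-canonical form: `1` is the left and a positive definite `ρ` the
right eigenvector of the transfer matrix for the eigenvalue `1`, which is the unique dominant
eigenvalue: it has a one-dimensional eigenspace, and every other eigenvalue lies strictly inside
the unit circle. -/
structure IsInjectiveMPS {d D : ℕ} (A : Fin d → Matrix (Fin D) (Fin D) ℂ) : Prop where
  bond_pos : 0 < D
  left_canonical : ∑ s, (A s)ᴴ * A s = 1
  right_canonical : ∃ ρ : Matrix (Fin D) (Fin D) ℂ, ρ.PosDef ∧ ∑ s, A s * ρ * (A s)ᴴ = ρ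
  gap : ∀ (μ : ℂ) (X : Matrix (Fin D) (Fin D) ℂ), X ≠ 0 → transfer A X = μ • X →
    ‖μ‖ < 1 ∨ (μ = 1 ∧ ∃ a : ℂ, X = a • (1 : Matrix (Fin D) (Fin D) ℂ))

/-- `A` generates a translation invariant injective MPS with the tilted exponential symmetry
generated by an on-site unitary `U` of order `N`: the symmetry is well defined on a periodic
chain of `L` sites, and for every `k ≥ 1` the MPS on `k * L` sites is an eigenstate of the
periodically extended symmetry operators. -/
structure IsSymmetricMPS {d D : ℕ} (N b L : ℕ) (U : Matrix (Fin d) (Fin d) ℂ)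
    (A : Fin d → Matrix (Fin D) (Fin D) ℂ) : Prop where
  unitary : U ∈ Matrix.unitaryGroup (Fin d) ℂ
  order : orderOf U = N
  ring_exp : WellDefinedOnRing U (expMod b) L
  ring_dipExp : WellDefinedOnRing U (dipExpMod b) L
  injective : IsInjectiveMPS A
  symmetric : ∀ (g : G N) (k : ℕ), 1 ≤ k → ∃ c : Circle,
    symOp N b L k U g *ᵥ mpsState A (k * L) = (c : ℂ) • mpsState A (k * L)

/-! ### Bond unitaries -/

/-- Equality up to a phase. -/
def PhaseEq {D : ℕ} (X Y : Matrix (Fin D) (Fin D) ℂ) : Prop :=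
  ∃ c : Circle, X = (c : ℂ) • Y

/-- `v j g` is a system of unitaries on the bonds `j = 0, 1, 2, …` (site `j + 1` lies between the
bonds `j` and `j + 1`) through which the symmetry is pushed:
`U_{g,j+1} · A ≐ v_j(g)† A v_{j+1}(g)`. -/
structure IsBondUnitaries {d D : ℕ} (N b : ℕ) (U : Matrix (Fin d) (Fin d) ℂ)
    (A : Fin d → Matrix (Fin D) (Fin D) ℂ) (v : ℕ → G N → Matrix (Fin D) (Fin D) ℂ) : Prop where
  unitary : ∀ j g, v j g ∈ Matrix.unitaryGroup (Fin D) ℂ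
  push : ∀ j g, ∃ c : Circle, ∀ s,
    ∑ s', onSite N b U g (j + 1) s s' • A s' = (c : ℂ) • ((v j g)ᴴ * A s * v (j + 1) g)

/-- Bond unitary of the element `g` of the exponential symmetry. -/
def vE {D N : ℕ} (v : ℕ → G N → Matrix (Fin D) (Fin D) ℂ) (j : ℕ) (g : ZMod N) :
    Matrix (Fin D) (Fin D) ℂ := v j (g, 0)

/-- Bond unitary of the element `g` of the dipole-exponential symmetry. -/
def vDE {D N : ℕ} (v : ℕ → G N → Matrix (Fin D) (Fin D) ℂ) (j : ℕ) (g : ZMod N) :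
    Matrix (Fin D) (Fin D) ℂ := v j (0, g)

/-- The (strong) SPT class of the MPS is `c ∈ H²(ℤ_N × ℤ_N, U(1))`: bond unitaries exist, and
for every choice of them they form, on every bond, a projective representation of class `c`. -/
def HasSPTClass {d D : ℕ} (N b : ℕ) (U : Matrix (Fin d) (Fin d) ℂ)
    (A : Fin d → Matrix (Fin D) (Fin D) ℂ) (c : H2 (G N)) : Prop :=
  (∃ v, IsBondUnitaries N b U A v) ∧
  ∀ v, IsBondUnitaries N b U A v → ∀ j, ∃ ω : Z2 (G N),
    (∀ g h, v j g * v j h = (ω.1 g h : ℂ) • v j (g + h)) ∧ H2.mk ω = c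

/-- `c` is the SPT class of some injective MPS with the tilted exponential symmetry on a chain of
length `L` (for some physical dimension, on-site unitary of order `N`, and bond dimension). -/
def IsSPTClass (N b L : ℕ) (c : H2 (G N)) : Prop :=
  ∃ (d D : ℕ) (U : Matrix (Fin d) (Fin d) ℂ) (A : Fin d → Matrix (Fin D) (Fin D) ℂ),
    IsSymmetricMPS N b L U A ∧ HasSPTClass N b U A c

/-- The phase `exp(2πik/N)` of `k ∈ ℤ_N`. -/
def phase (N : ℕ) (k : ZMod N) : ℂ :=
  Complex.exp (2 * Real.pi * Complex.I * (k.val : ℂ) / (N : ℂ))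

end TiltedExp

end

/-!
The class of a 2-cocycle `ω` on a finite abelian group is determined by the alternating bicharacter
`ω(g, h) / ω(h, g)`; on `ℤ_N × ℤ_N` this is the single `N`-th root of unity `e^{2πik/N}`.

If two left-canonical injective tensors generate the same ring states up to a phase, then the
mixed transfer matrix has an eigenvalue of modulus one, and Cauchy–Schwarz forces its eigenvectors
to be multiples of unitaries intertwining the tensors; these are the bond unitaries, unique up to a
phase. Uniqueness turns the relations `U^{b^{j+1}} = (U^{b^j})^b` and
`U^{(j+2)b^{j+1}} = (U^{(j+1)b^j})^b U^{b^{j+1}}` on the sites into the recursion on the bonds, so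
that the commutation phase on a bond is the `b²`-th power of that on the previous one. It is
also equal to it, because the on-site operators commute; hence `k(b² - 1) ≡ 0`.

Conversely, if `k(b² - 1) ≡ 0`, then `e^{-2πibk/N}` has an order `n` that divides `N` and `b² - 1`,
and the cluster-state tensor `N^{-1/2} χ(as - bs²) |a⟩⟨s|` built from the character `χ` of `ℤ_n`
with this value at `1`, together with the cyclic shift of the physical label, realises `k`: its
bond unitaries are generated by the generalised Pauli matrices `Z^{-1} X^b` and `Z^{-1}`.
-/

noncomputable section

namespace TiltedExp

section Cohomology

variable {G : Type*} [AddCommGroup G]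

namespace Z2

theorem zero_left (ω : Z2 G) (g : G) : ω.1 0 g = ω.1 0 0 := by
  have h := ω.2 0 0 g
  rw [zero_add, zero_add] at h
  exact (mul_right_cancel h).symm

theorem zero_right (ω : Z2 G) (g : G) : ω.1 g 0 = ω.1 0 0 := by
  have h := ω.2 g 0 0
  rw [add_zero, add_zero] at h
  exact mul_right_cancel h

theorem neg_left (ω : Z2 G) (g : G) : ω.1 (-g) g = ω.1 g (-g) := by
  have h := ω.2 g (-g) g
  rw [add_neg_cancel, neg_add_cancel, zero_left, zero_right ω g] at h
  exact (mul_right_cancel h).symm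

/-- The commutator form `(g, h) ↦ ω(g, h) / ω(h, g)` of a cocycle, which is bimultiplicative:
`commutatorChar ω h` is the resulting character of the variable `g`. -/
def commutatorChar : Z2 G →* G → AddChar G Circle where
  toFun ω h :=
    { toFun := fun g => ω.1 g h / ω.1 h g
      map_zero_eq_one' := div_eq_one.2 ((zero_left ω h).trans (zero_right ω h).symm)
      map_add_eq_mul' := fun g g' => by
        rw [div_mul_div_comm, div_eq_div_iff_mul_eq_mul]
        refine mul_right_cancel (b := ω.1 g g' * ω.1 (h + g) g') ?_
        calc ω.1 (g + g') h * (ω.1 h g * ω.1 h g') * (ω.1 g g' * ω.1 (h + g) g')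
            = ω.1 g g' * ω.1 (g + g') h * (ω.1 h g * ω.1 (h + g) g') * ω.1 h g' := by ac_rfl
          _ = ω.1 g' h * ω.1 g (g' + h) * (ω.1 g g' * ω.1 h (g + g')) * ω.1 h g' := by
              rw [ω.2 g g' h, ω.2 h g g']
          _ = ω.1 h g' * ω.1 g (h + g') * (ω.1 g' h * ω.1 g g' * ω.1 h (g + g')) := by
              rw [add_comm g' h]; ac_rfl
          _ = ω.1 g h * ω.1 (g + h) g' * (ω.1 g' h * ω.1 g g' * ω.1 h (g + g')) := by
              rw [ω.2 g h g']
          _ = ω.1 g h * ω.1 g' h * ω.1 h (g + g') * (ω.1 g g' * ω.1 (h + g) g') := by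
              rw [add_comm g h]; ac_rfl }
  map_one' := funext fun _ => DFunLike.ext _ _ fun _ => div_self' _
  map_mul' _ _ := funext fun _ => DFunLike.ext _ _ fun _ => mul_div_mul_comm _ _ _ _

theorem commutatorChar_apply (ω : Z2 G) (g h : G) :
    commutatorChar ω h g = ω.1 g h / ω.1 h g := rfl

theorem commutatorChar_swap (ω : Z2 G) (g h : G) :
    commutatorChar ω g h = (commutatorChar ω h g)⁻¹ := by
  rw [commutatorChar_apply, commutatorChar_apply, inv_div]

theorem commutatorChar_self (ω : Z2 G) (g : G) : commutatorChar ω g g = 1 := div_self' _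

theorem commutatorChar_eq_one_of_mem_B2 {ω : Z2 G} (hω : ω ∈ B2 G) : commutatorChar ω = 1 := by
  obtain ⟨β, hβ⟩ := hω
  refine funext fun h => DFunLike.ext _ _ fun g => ?_
  rw [commutatorChar_apply, hβ, hβ, mul_comm (β h), add_comm h, div_self']
  rfl

end Z2

/-- The central extension of `G` by `U(1)` defined by a 2-cocycle: pairs in `G × U(1)`, with
product `(g, z) (h, w) = (g + h, z w ω(g, h))`. -/
@[ext] structure CentralExt (ω : Z2 G) where
  /-- The image in `G`. -/
  base : G
  /-- The component in `U(1)`. -/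
  phase : Circle

namespace CentralExt

variable {ω : Z2 G}

instance : Mul (CentralExt ω) :=
  ⟨fun x y => ⟨x.base + y.base, x.phase * y.phase * ω.1 x.base y.base⟩⟩

instance : One (CentralExt ω) := ⟨⟨0, (ω.1 0 0)⁻¹⟩⟩

instance : Inv (CentralExt ω) :=
  ⟨fun x => ⟨-x.base, (x.phase * ω.1 x.base (-x.base) * ω.1 0 0)⁻¹⟩⟩

theorem mul_def (x y : CentralExt ω) :
    x * y = ⟨x.base + y.base, x.phase * y.phase * ω.1 x.base y.base⟩ := rfl

theorem one_def : (1 : CentralExt ω) = ⟨0, (ω.1 0 0)⁻¹⟩ := rfl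

theorem inv_def (x : CentralExt ω) :
    x⁻¹ = ⟨-x.base, (x.phase * ω.1 x.base (-x.base) * ω.1 0 0)⁻¹⟩ := rfl

instance : Group (CentralExt ω) := Group.ofLeftAxioms
  (fun x y z => by
    refine CentralExt.ext (add_assoc _ _ _) ?_
    simp only [mul_def]
    calc x.phase * y.phase * ω.1 x.base y.base * z.phase * ω.1 (x.base + y.base) z.base
        = x.phase * y.phase * z.phase *
            (ω.1 x.base y.base * ω.1 (x.base + y.base) z.base) := by ac_rfl
      _ = x.phase * y.phase * z.phase *
            (ω.1 y.base z.base * ω.1 x.base (y.base + z.base)) := by rw [ω.2]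
      _ = x.phase * (y.phase * z.phase * ω.1 y.base z.base) *
            ω.1 x.base (y.base + z.base) := by ac_rfl)
  (fun x => by
    refine CentralExt.ext (zero_add _) ?_
    simp only [mul_def, one_def]
    rw [Z2.zero_left ω x.base, mul_right_comm, inv_mul_cancel, one_mul])
  (fun x => by
    refine CentralExt.ext (neg_add_cancel _) ?_
    simp only [mul_def, one_def, inv_def]
    rw [Z2.neg_left, mul_inv_rev, mul_assoc _ x.phase, inv_mul_cancel_right])

/-- The inclusion of `U(1)` as the central subgroup. -/
def ofCircle (ω : Z2 G) : Circle →* CentralExt ω where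
  toFun z := ⟨0, z * (ω.1 0 0)⁻¹⟩
  map_one' := by rw [one_mul, one_def]
  map_mul' z w := by
    refine CentralExt.ext (add_zero 0).symm ?_
    simp only [mul_def]
    rw [← mul_assoc, inv_mul_cancel_right, mul_right_comm]

theorem ofCircle_injective (ω : Z2 G) : Function.Injective (ofCircle ω) := fun _ _ h =>
  mul_right_cancel (congrArg phase h)

theorem mk_mul_mk (g h : G) :
    (⟨g, 1⟩ * ⟨h, 1⟩ : CentralExt ω) = ofCircle ω (ω.1 g h) * ⟨g + h, 1⟩ := by
  simp only [mul_def, ofCircle, MonoidHom.coe_mk, OneHom.coe_mk]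
  rw [zero_add, Z2.zero_left ω (g + h), one_mul, one_mul, mul_one, inv_mul_cancel_right]

end CentralExt

theorem exists_circle_pow_eq {n : ℕ} (hn : n ≠ 0) (z : Circle) : ∃ w : Circle, w ^ n = z := by
  refine ⟨Circle.exp (Complex.arg z / n), ?_⟩
  rw [← Circle.exp_nsmul, nsmul_eq_mul, mul_div_cancel₀ _ (Nat.cast_ne_zero.2 hn), Circle.exp_arg]

theorem exists_monoidHom_circle_extension {A B : Type*} [CommGroup A] [CommGroup B]
    {i : A →* B} (hi : Function.Injective i) (f : A →* Circle) :
    ∃ r : B →* Circle, ∀ a, r (i a) = f a := by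
  let : DivisibleBy (Additive Circle) ℕ :=
    divisibleByOfSMulRightSurj (Additive Circle) ℕ fun hn => exists_circle_pow_eq hn
  let : DivisibleBy (Additive Circle) ℤ := AddGroup.divisibleByIntOfDivisibleByNat _
  obtain ⟨r, hr⟩ := (Module.Baer.of_divisible (Additive Circle)).extension_property_addMonoidHom
    i.toAdditive hi f.toAdditive
  exact ⟨MonoidHom.toAdditive.symm r, fun a => congrArg Additive.toMul (DFunLike.congr_fun hr a)⟩

/-- A symmetric cocycle defines an abelian extension of `G` by `U(1)`, which splits because
`U(1)` is divisible. -/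
theorem Z2.mem_B2_of_symm {ω : Z2 G} (hω : ∀ g h, ω.1 g h = ω.1 h g) : ω ∈ B2 G := by
  let : CommGroup (CentralExt ω) :=
    { mul_comm := fun x y => by
        rw [CentralExt.mul_def, CentralExt.mul_def, add_comm, mul_comm x.phase, hω] }
  obtain ⟨r, hr⟩ := exists_monoidHom_circle_extension (CentralExt.ofCircle_injective ω)
    (MonoidHom.id Circle)
  refine ⟨fun g => r ⟨g, 1⟩, fun g h => ?_⟩
  rw [← map_mul, CentralExt.mk_mul_mk, map_mul, hr, mul_inv_cancel_right, MonoidHom.id_apply]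

theorem Z2.ker_commutatorChar : (commutatorChar (G := G)).ker = B2 G := by
  refine le_antisymm (fun ω hω => mem_B2_of_symm fun g h => ?_)
    fun ω => commutatorChar_eq_one_of_mem_B2
  exact div_eq_one.1 (DFunLike.congr_fun (congrFun hω h) g)

theorem H2.mk_eq_mk_iff {ω₁ ω₂ : Z2 G} :
    H2.mk ω₁ = H2.mk ω₂ ↔ Z2.commutatorChar ω₁ = Z2.commutatorChar ω₂ := by
  rw [eq_comm (a := Z2.commutatorChar ω₁), MonoidHom.eq_iff, Z2.ker_commutatorChar]
  exact QuotientGroup.eq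

end Cohomology

section ZModSq

variable {N : ℕ} [NeZero N]

theorem addChar_ext_zmod_sq {M : Type*} [Monoid M] {χ ψ : AddChar (G N) M}
    (hE : χ (1, 0) = ψ (1, 0)) (hD : χ (0, 1) = ψ (0, 1)) : χ = ψ := by
  refine DFunLike.ext _ _ fun g => ?_
  have hg : g = g.1.val • (1, 0) + g.2.val • (0, 1) := by ext <;> simp
  rw [hg, AddChar.map_add_eq_mul, AddChar.map_add_eq_mul]
  simp only [AddChar.map_nsmul_eq_pow, hE, hD]

namespace Z2

theorem commutatorChar_eq_iff {ω₁ ω₂ : Z2 (G N)} :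
    commutatorChar ω₁ = commutatorChar ω₂ ↔
      commutatorChar ω₁ (0, 1) (1, 0) = commutatorChar ω₂ (0, 1) (1, 0) := by
  refine ⟨fun h => by rw [h], fun h => funext fun g => ?_⟩
  have hE : commutatorChar ω₁ (1, 0) = commutatorChar ω₂ (1, 0) :=
    addChar_ext_zmod_sq (by rw [commutatorChar_self, commutatorChar_self])
      (by rw [commutatorChar_swap, h, ← commutatorChar_swap])
  have hD : commutatorChar ω₁ (0, 1) = commutatorChar ω₂ (0, 1) :=
    addChar_ext_zmod_sq h (by rw [commutatorChar_self, commutatorChar_self])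
  exact addChar_ext_zmod_sq (by rw [commutatorChar_swap, hE, ← commutatorChar_swap])
    (by rw [commutatorChar_swap, hD, ← commutatorChar_swap])

/-- The bilinear cocycle `ω((m, n), (m', n')) = exp(2πi k m n' / N)`. -/
def bilinear : Multiplicative (ZMod N) →* Z2 (G N) where
  toFun k := ⟨fun g h => ZMod.toCircle (k.toAdd * (g.1 * h.2)), fun g h l => by
    simp only [← AddChar.map_add_eq_mul, Prod.fst_add, Prod.snd_add]
    congr 1
    ring⟩
  map_one' := Subtype.ext <| funext₂ fun g h => by simp
  map_mul' k l := Subtype.ext <| funext₂ fun g h => by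
    change ZMod.toCircle ((k.toAdd + l.toAdd) * _) = ZMod.toCircle _ * ZMod.toCircle _
    rw [← AddChar.map_add_eq_mul, add_mul]

theorem commutatorChar_bilinear (k : Multiplicative (ZMod N)) :
    commutatorChar (bilinear k) (0, 1) (1, 0) = ZMod.toCircle k.toAdd := by
  simp [commutatorChar_apply, bilinear]

end Z2

theorem exists_toCircle_eq {c : Circle} (hc : c ^ N = 1) :
    ∃ k : ZMod N, ZMod.toCircle k = c := by
  obtain ⟨k, hk⟩ := (bijective_rootsOfUnityAddChar N).2
    ⟨toUnits c, by rw [mem_rootsOfUnity, ← map_pow, hc, map_one]⟩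
  refine ⟨k, ?_⟩
  simpa using congrArg (fun u : rootsOfUnity N Circle => ((u : Circleˣ) : Circle)) hk

theorem mk_bilinear_eq_iff {k : Multiplicative (ZMod N)} {ω : Z2 (G N)} :
    H2.mk (Z2.bilinear k) = H2.mk ω ↔
      ZMod.toCircle k.toAdd = Z2.commutatorChar ω (0, 1) (1, 0) := by
  rw [H2.mk_eq_mk_iff, Z2.commutatorChar_eq_iff, Z2.commutatorChar_bilinear]

theorem mk_bilinear_bijective :
    Function.Bijective ((QuotientGroup.mk' (B2 (G N))).comp Z2.bilinear) := by
  refine ⟨fun k l h => ?_, fun c => ?_⟩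
  · exact Multiplicative.toAdd.injective (ZMod.injective_toCircle
      ((mk_bilinear_eq_iff.1 h).trans (Z2.commutatorChar_bilinear l)))
  · obtain ⟨ω, rfl⟩ := QuotientGroup.mk_surjective c
    obtain ⟨k, hk⟩ := exists_toCircle_eq (c := Z2.commutatorChar ω (0, 1) (1, 0)) (by
      rw [← AddChar.map_nsmul_eq_pow, Prod.smul_mk, nsmul_one, CharP.cast_eq_zero, smul_zero,
        ← Prod.zero_eq_mk, AddChar.map_zero_eq_one])
    exact ⟨Multiplicative.ofAdd k, mk_bilinear_eq_iff.2 hk⟩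

/-- The isomorphism `H²(ℤ_N × ℤ_N, U(1)) ≅ ℤ_N` sending `[ω]` to the label `k` of its commutator
phase `ω(e, f) / ω(f, e) = exp(2πik/N)`. -/
def phaseLabel (N : ℕ) [NeZero N] : H2 (G N) ≃* Multiplicative (ZMod N) :=
  (MulEquiv.ofBijective _ mk_bilinear_bijective).symm

theorem toCircle_phaseLabel (ω : Z2 (G N)) :
    ZMod.toCircle (phaseLabel N (H2.mk ω)).toAdd = Z2.commutatorChar ω (0, 1) (1, 0) :=
  mk_bilinear_eq_iff.1 ((MulEquiv.ofBijective _ mk_bilinear_bijective).apply_symm_apply _)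

theorem phase_eq_toCircle (k : ZMod N) : phase N k = ZMod.toCircle k :=
  (ZMod.toCircle_apply k).symm

theorem div_eq_phase_phaseLabel (ω : Z2 (G N)) :
    (ω.1 (1, 0) (0, 1) : ℂ) / (ω.1 (0, 1) (1, 0) : ℂ) =
      phase N (phaseLabel N (H2.mk ω)).toAdd := by
  rw [phase_eq_toCircle, toCircle_phaseLabel, Z2.commutatorChar_apply, Circle.coe_div]

theorem exists_torsion_subgroup {H : Type*} [CommGroup H] (κ : H ≃* Multiplicative (ZMod N))
    (m : ℕ) : ∃ P : Subgroup H, (∀ c, c ∈ P ↔ (κ c).toAdd * (m : ZMod N) = 0) ∧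
      Nonempty (P ≃* Multiplicative (ZMod (Nat.gcd m N))) := by
  have : Finite H := .of_equiv _ κ.symm.toEquiv
  have : IsCyclic H := κ.symm.isCyclic.1 inferInstance
  refine ⟨(powMonoidHom m : H →* H).ker, fun c => ?_, ⟨mulEquivOfCyclicCardEq ?_⟩⟩
  · rw [MonoidHom.mem_ker, powMonoidHom_apply, ← map_eq_one_iff κ κ.injective, map_pow,
      ← toAdd_eq_zero, toAdd_pow, nsmul_eq_mul, mul_comm]
  · rw [IsCyclic.card_powMonoidHom_ker, Nat.card_congr κ.toEquiv,
      Nat.card_congr Multiplicative.toAdd, Nat.card_zmod,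
      Nat.card_congr Multiplicative.toAdd, Nat.card_zmod, Nat.gcd_comm]

end ZModSq

/-! ### Unitary matrices and equality up to a phase -/

section Unitary

variable {n : Type*} [Fintype n] [DecidableEq n] {X Y : Matrix n n ℂ}

theorem conjTranspose_mul_self_of_mem (hX : X ∈ Matrix.unitaryGroup n ℂ) : Xᴴ * X = 1 :=
  Matrix.mem_unitaryGroup_iff'.1 hX

theorem mul_conjTranspose_self_of_mem (hX : X ∈ Matrix.unitaryGroup n ℂ) : X * Xᴴ = 1 :=
  Matrix.mem_unitaryGroup_iff.1 hX

theorem conjTranspose_mul_mul_ne_zero {Z : Matrix n n ℂ} (hX : X ∈ Matrix.unitaryGroup n ℂ)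
    (hY : Y ∈ Matrix.unitaryGroup n ℂ) (hZ : Z ≠ 0) : Xᴴ * Z * Y ≠ 0 := fun h₀ => hZ <| by
  calc Z = X * Xᴴ * Z * (Y * Yᴴ) := by
        rw [mul_conjTranspose_self_of_mem hX, mul_conjTranspose_self_of_mem hY, one_mul, mul_one]
    _ = X * (Xᴴ * Z * Y) * Yᴴ := by simp only [Matrix.mul_assoc]
    _ = 0 := by rw [h₀, mul_zero, zero_mul]

open scoped Matrix.Norms.L2Operator in
theorem norm_eq_one_of_smul_mem_unitaryGroup [Nonempty n] {a : ℂ}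
    (hX : X ∈ Matrix.unitaryGroup n ℂ) (ha : a • X ∈ Matrix.unitaryGroup n ℂ) : ‖a‖ = 1 := by
  rw [← CStarRing.norm_of_mem_unitary ha, norm_smul, CStarRing.norm_of_mem_unitary hX, mul_one]

theorem circle_smul_mem_unitaryGroup (hX : X ∈ Matrix.unitaryGroup n ℂ) (c : Circle) :
    (c : ℂ) • X ∈ Matrix.unitaryGroup n ℂ := by
  rw [Matrix.mem_unitaryGroup_iff, star_smul, Matrix.smul_mul, Matrix.mul_smul,
    Matrix.mem_unitaryGroup_iff.1 hX, smul_smul, Complex.star_def, Complex.mul_conj,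
    Circle.normSq_coe, Complex.ofReal_one, one_smul]

theorem smul_left_injective_of_mem_unitaryGroup [Nonempty n]
    (hX : X ∈ Matrix.unitaryGroup n ℂ) : Function.Injective fun a : ℂ => a • X := by
  refine smul_left_injective ℂ ?_
  rintro rfl
  exact zero_ne_one ((mul_zero _).symm.trans (conjTranspose_mul_self_of_mem hX))

theorem commutator_eq_smul_one {q : ℂ} (hX : X ∈ Matrix.unitaryGroup n ℂ)
    (hY : Y ∈ Matrix.unitaryGroup n ℂ) (h : X * Y = q • (Y * X)) : X * Y * Xᴴ * Yᴴ = q • 1 := by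
  rw [h, Matrix.smul_mul, Matrix.smul_mul, Matrix.mul_assoc Y,
    mul_conjTranspose_self_of_mem hX, mul_one, mul_conjTranspose_self_of_mem hY]

theorem pow_mul_pow_of_mul_eq_smul {R : Type*} [Monoid R] [MulAction ℂ R]
    [IsScalarTower ℂ R R] [SMulCommClass ℂ R R] {x y : R} {q : ℂ} (h : x * y = q • (y * x))
    (k l : ℕ) : x ^ k * y ^ l = q ^ (k * l) • (y ^ l * x ^ k) := by
  have hk : ∀ k, x ^ k * y = q ^ k • (y * x ^ k) := fun k => by
    induction k with
    | zero => simp only [pow_zero, one_mul, mul_one, one_smul]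
    | succ k ih =>
      rw [pow_succ, mul_assoc, h, mul_smul_comm, ← mul_assoc, ih, smul_mul_assoc, smul_smul,
        pow_succ', mul_assoc]
  induction l with
  | zero => simp only [pow_zero, mul_one, one_mul, mul_zero, one_smul]
  | succ l ih =>
    rw [pow_succ, ← mul_assoc, ih, smul_mul_assoc, mul_assoc, hk, mul_smul_comm, smul_smul,
      ← pow_add, mul_assoc, mul_add, mul_one]

end Unitary

namespace PhaseEq

variable {D : ℕ} {X Y Z X' Y' : Matrix (Fin D) (Fin D) ℂ}

theorem refl (X : Matrix (Fin D) (Fin D) ℂ) : PhaseEq X X := ⟨1, (one_smul ℂ X).symm⟩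

theorem symm : PhaseEq X Y → PhaseEq Y X := by
  rintro ⟨c, rfl⟩
  exact ⟨c⁻¹, by rw [smul_smul, ← Circle.coe_mul, inv_mul_cancel, Circle.coe_one, one_smul]⟩

theorem trans : PhaseEq X Y → PhaseEq Y Z → PhaseEq X Z := by
  rintro ⟨c, rfl⟩ ⟨c', rfl⟩
  exact ⟨c * c', by rw [smul_smul, Circle.coe_mul]⟩

theorem mul : PhaseEq X Y → PhaseEq X' Y' → PhaseEq (X * X') (Y * Y') := by
  rintro ⟨c, rfl⟩ ⟨c', rfl⟩
  exact ⟨c * c', by rw [Matrix.smul_mul, Matrix.mul_smul, smul_smul, Circle.coe_mul]⟩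

theorem map (f : Module.End ℂ (Matrix (Fin D) (Fin D) ℂ)) : PhaseEq X Y → PhaseEq (f X) (f Y) := by
  rintro ⟨c, rfl⟩
  exact ⟨c, map_smul f _ _⟩

theorem mem_unitaryGroup (h : PhaseEq X Y) (hY : Y ∈ Matrix.unitaryGroup (Fin D) ℂ) :
    X ∈ Matrix.unitaryGroup (Fin D) ℂ := by
  obtain ⟨c, rfl⟩ := h
  exact circle_smul_mem_unitaryGroup hY c

theorem of_eq_smul {a : ℂ} (hX : X ∈ Matrix.unitaryGroup (Fin D) ℂ)
    (hY : Y ∈ Matrix.unitaryGroup (Fin D) ℂ) (h : X = a • Y) : PhaseEq X Y := by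
  cases isEmpty_or_nonempty (Fin D)
  · exact ⟨1, Subsingleton.elim _ _⟩
  · exact ⟨⟨a, mem_sphere_zero_iff_norm.2 (norm_eq_one_of_smul_mem_unitaryGroup hY (h ▸ hX))⟩, h⟩

theorem multiplier_eq [NeZero D] {q q' : ℂ} (hX : PhaseEq X X') (hY : PhaseEq Y Y')
    (hX' : X' ∈ Matrix.unitaryGroup (Fin D) ℂ) (hY' : Y' ∈ Matrix.unitaryGroup (Fin D) ℂ)
    (h : X * Y = q • (Y * X)) (h' : X' * Y' = q' • (Y' * X')) : q = q' := by
  obtain ⟨c, rfl⟩ := hX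
  obtain ⟨c', rfl⟩ := hY
  simp only [Matrix.smul_mul, Matrix.mul_smul, smul_smul, h'] at h
  have hcancel : q * (c' * c) = q' * (c' * c) := by
    simpa only [mul_comm, mul_left_comm] using
      (smul_left_injective_of_mem_unitaryGroup (mul_mem hY' hX') h).symm
  exact mul_right_cancel₀ (mul_ne_zero c'.coe_ne_zero c.coe_ne_zero) hcancel

end PhaseEq

/-! ### Powers of an endomorphism with a spectral gap -/

section Powers

open Filter Topology

theorem tendsto_pow_zero_of_spectralRadius_lt_one {A : Type*} [NormedRing A] [NormedAlgebra ℂ A]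
    [CompleteSpace A] {a : A} (ha : spectralRadius ℂ a < 1) :
    Tendsto (fun n : ℕ => a ^ n) atTop (𝓝 0) := by
  obtain ⟨r, har, hr⟩ := ENNReal.lt_iff_exists_nnreal_btwn.1 ha
  refine squeeze_zero_norm' (a := fun n : ℕ => (r : ℝ) ^ n) ?_
    (tendsto_pow_atTop_nhds_zero_of_lt_one r.2 (by exact_mod_cast hr))
  filter_upwards [(spectrum.pow_nnnorm_pow_one_div_tendsto_nhds_spectralRadius
    a).eventually_lt_const har, eventually_gt_atTop 0] with n hn hn0
  have h := ENNReal.rpow_le_rpow hn.le (Nat.cast_nonneg n)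
  rw [← ENNReal.rpow_mul, one_div, inv_mul_cancel₀ (by exact_mod_cast hn0.ne'), ENNReal.rpow_one,
    ENNReal.rpow_natCast, ← ENNReal.coe_pow, ENNReal.coe_le_coe] at h
  exact_mod_cast h

theorem sub_pow_succ_of_absorbing {R : Type*} [Ring R] {t p : R} (htp : t * p = p)
    (hpt : p * t = p) (hp : IsIdempotentElem p) (n : ℕ) :
    (t - p) ^ (n + 1) = t ^ (n + 1) - p := by
  have hpt' : ∀ m, p * t ^ m = p := fun m => by
    induction m with
    | zero => rw [pow_zero, mul_one]
    | succ m ih => rw [pow_succ, ← mul_assoc, ih, hpt]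
  induction n with
  | zero => simp only [zero_add, pow_one]
  | succ n ih =>
    rw [pow_succ', ih, sub_mul, mul_sub, mul_sub, htp, hp.eq, hpt', ← pow_succ', sub_self,
      sub_zero]

variable {V W : Type*} [AddCommGroup V] [Module ℂ V] [FiniteDimensional ℂ V]
  [AddCommGroup W] [Module ℂ W] [TopologicalSpace W] [IsTopologicalAddGroup W]
  [ContinuousSMul ℂ W]

attribute [local instance] Matrix.linftyOpNormedRing Matrix.linftyOpNormedAlgebra in
theorem tendsto_linearMap_pow_zero {T : Module.End ℂ V}
    (hT : ∀ μ, T.HasEigenvalue μ → ‖μ‖ < 1) (φ : Module.End ℂ V →ₗ[ℂ] W) :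
    Tendsto (fun n : ℕ => φ (T ^ n)) atTop (𝓝 0) := by
  let toMat := LinearMap.toMatrixAlgEquiv (Module.finBasis ℂ V)
  have hφ : Continuous (φ ∘ₗ toMat.symm.toLinearMap) := LinearMap.continuous_of_finiteDimensional _
  have hpow : Tendsto (fun n : ℕ => toMat T ^ n) atTop (𝓝 0) := by
    cases isEmpty_or_nonempty (Fin (Module.finrank ℂ V))
    · exact tendsto_const_nhds.congr fun n => Subsingleton.elim 0 _
    refine tendsto_pow_zero_of_spectralRadius_lt_one
      (spectrum.spectralRadius_lt_of_forall_lt (r := 1) _ fun μ hμ => hT μ ?_)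
    rwa [Module.End.hasEigenvalue_iff_mem_spectrum, ← AlgEquiv.spectrum_eq toMat]
  have h := (hφ.tendsto 0).comp hpow
  rw [map_zero] at h
  refine h.congr fun n => ?_
  rw [Function.comp_apply, ← map_pow]
  exact congrArg φ (toMat.symm_apply_apply _)

theorem tendsto_linearMap_pow {T P : Module.End ℂ V} (hTP : T * P = P) (hPT : P * T = P)
    (hP : IsIdempotentElem P) (hgap : ∀ μ, (T - P).HasEigenvalue μ → ‖μ‖ < 1)
    (φ : Module.End ℂ V →ₗ[ℂ] W) : Tendsto (fun n : ℕ => φ (T ^ n)) atTop (𝓝 (φ P)) := by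
  have h := ((tendsto_linearMap_pow_zero hgap φ).comp (tendsto_add_atTop_nat 1)).add_const (φ P)
  rw [zero_add] at h
  refine (tendsto_add_atTop_iff_nat 1).1 (h.congr fun n => ?_)
  rw [Function.comp_apply, sub_pow_succ_of_absorbing hTP hPT hP, map_sub, sub_add_cancel]

end Powers

/-! ### Transfer matrices -/

section Transfer

variable {m n s : Type*} [Fintype m] [Fintype n] [Fintype s]

/-- The mixed transfer matrix `X ↦ ∑ₛ Bₛ† X Aₛ` of two MPS tensors. -/
def mixedTransfer (B : s → Matrix m m ℂ) (A : s → Matrix n n ℂ) :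
    Module.End ℂ (Matrix m n ℂ) where
  toFun X := ∑ i, (B i)ᴴ * X * A i
  map_add' X Y := by simp only [Matrix.mul_add, Matrix.add_mul, Finset.sum_add_distrib]
  map_smul' c X := by
    simp only [Matrix.mul_smul, Matrix.smul_mul, Finset.smul_sum, RingHom.id_apply]

/-- The sesquilinear form `⟨X, Y⟩ = Tr(ρ X† Y)` on bond matrices. -/
def traceForm (ρ : Matrix n n ℂ) : Matrix m n ℂ →ₗ⋆[ℂ] Matrix m n ℂ →ₗ[ℂ] ℂ :=
  LinearMap.mk₂'ₛₗ (starRingEnd ℂ) (RingHom.id ℂ) (fun X Y => (ρ * (Xᴴ * Y)).trace)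
    (fun X X' Y => by
      rw [Matrix.conjTranspose_add, Matrix.add_mul, Matrix.mul_add, Matrix.trace_add])
    (fun c X Y => by
      rw [Matrix.conjTranspose_smul, Matrix.smul_mul, Matrix.mul_smul, Matrix.trace_smul]; rfl)
    (fun X Y Y' => by rw [Matrix.mul_add, Matrix.mul_add, Matrix.trace_add])
    (fun c X Y => by rw [Matrix.mul_smul, Matrix.mul_smul, Matrix.trace_smul]; rfl)

variable {A : s → Matrix n n ℂ} {B : s → Matrix m m ℂ} {ρ : Matrix n n ℂ} {X Y : Matrix m n ℂ}

theorem mixedTransfer_apply : mixedTransfer B A X = ∑ i, (B i)ᴴ * X * A i := rfl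

theorem traceForm_apply : traceForm ρ X Y = (ρ * (Xᴴ * Y)).trace := rfl

theorem traceForm_star_mul_self (R : Matrix n n ℂ) :
    traceForm (star R * R) X X = ((X * Rᴴ)ᴴ * (X * Rᴴ)).trace := by
  rw [traceForm_apply, Matrix.mul_assoc, Matrix.trace_mul_comm, Matrix.conjTranspose_mul,
    Matrix.conjTranspose_conjTranspose, Matrix.star_eq_conjTranspose]
  simp only [Matrix.mul_assoc]

open scoped MatrixOrder in
theorem exists_isUnit_eq_star_mul_self [DecidableEq n] (hρ : ρ.PosDef) :
    ∃ R : Matrix n n ℂ, IsUnit R ∧ ρ = star R * R :=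
  CStarAlgebra.isStrictlyPositive_iff_eq_star_mul_self.mp hρ.isStrictlyPositive

theorem traceForm_self_nonneg (hρ : ρ.PosDef) : 0 ≤ traceForm ρ X X := by
  classical
  obtain ⟨R, -, rfl⟩ := exists_isUnit_eq_star_mul_self hρ
  rw [traceForm_star_mul_self]
  exact (Matrix.posSemidef_conjTranspose_mul_self _).trace_nonneg

theorem eq_zero_of_traceForm_self_eq_zero (hρ : ρ.PosDef) (h : traceForm ρ X X = 0) : X = 0 := by
  classical
  obtain ⟨R, hR, rfl⟩ := exists_isUnit_eq_star_mul_self hρ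
  rw [traceForm_star_mul_self, Matrix.trace_conjTranspose_mul_self_eq_zero_iff] at h
  have : Invertible Rᴴ := hR.star.invertible
  rw [← Matrix.mul_invOf_cancel_right X Rᴴ, h, Matrix.zero_mul]

theorem star_traceForm (hρ : ρ.IsHermitian) : star (traceForm ρ X Y) = traceForm ρ Y X := by
  rw [traceForm_apply, ← Matrix.trace_conjTranspose, Matrix.conjTranspose_mul,
    Matrix.conjTranspose_mul, Matrix.conjTranspose_conjTranspose, hρ.eq, Matrix.trace_mul_comm,
    traceForm_apply]

theorem traceForm_self_of_mem_unitaryGroup [DecidableEq n] {V : Matrix n n ℂ}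
    (hV : V ∈ Matrix.unitaryGroup n ℂ) : traceForm ρ V V = ρ.trace := by
  rw [traceForm_apply, conjTranspose_mul_self_of_mem hV, mul_one]

theorem traceForm_smul_smul (c : ℂ) :
    traceForm ρ (c • X) (c • X) = (‖c‖ ^ 2 : ℝ) * traceForm ρ X X := by
  rw [map_smul, LinearMap.map_smulₛₗ₂, smul_eq_mul, smul_eq_mul, ← mul_assoc, Complex.mul_conj',
    Complex.ofReal_pow]

theorem sum_traceForm_mul_right (hA : ∑ i, A i * ρ * (A i)ᴴ = ρ) :
    ∑ i, traceForm ρ (X * A i) (Y * A i) = traceForm ρ X Y := by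
  calc ∑ i, traceForm ρ (X * A i) (Y * A i)
      = ∑ i, (A i * ρ * (A i)ᴴ * (Xᴴ * Y)).trace := Finset.sum_congr rfl fun i _ => by
        rw [traceForm_apply, Matrix.conjTranspose_mul, ← Matrix.mul_assoc _ Y, ← Matrix.mul_assoc,
          Matrix.trace_mul_comm]
        simp only [Matrix.mul_assoc]
    _ = traceForm ρ X Y := by rw [← Matrix.trace_sum, ← Matrix.sum_mul, hA, traceForm_apply]

theorem sum_traceForm_mul_left [DecidableEq m] (hB : ∑ i, (B i)ᴴ * B i = 1) :
    ∑ i, traceForm ρ (B i * X) (B i * Y) = traceForm ρ X Y := by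
  have h : ∀ i, (B i * X)ᴴ * (B i * Y) = Xᴴ * ((B i)ᴴ * B i * Y) := fun i => by
    simp only [Matrix.conjTranspose_mul, Matrix.mul_assoc]
  simp only [traceForm_apply, h]
  rw [← Matrix.trace_sum, ← Matrix.mul_sum, ← Matrix.mul_sum, ← Matrix.sum_mul, hB, Matrix.one_mul]

theorem sum_traceForm_mul_right_left :
    ∑ i, traceForm ρ (X * A i) (B i * Y) = traceForm ρ (mixedTransfer B A X) Y := by
  simp only [traceForm_apply, mixedTransfer_apply]
  rw [← Matrix.trace_sum, ← Matrix.mul_sum, Matrix.conjTranspose_sum, Matrix.sum_mul]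
  simp only [Matrix.conjTranspose_mul, Matrix.conjTranspose_conjTranspose, Matrix.mul_assoc]

theorem sum_traceForm_mul_left_right :
    ∑ i, traceForm ρ (B i * Y) (X * A i) = traceForm ρ Y (mixedTransfer B A X) := by
  simp only [traceForm_apply, mixedTransfer_apply]
  rw [← Matrix.trace_sum, ← Matrix.mul_sum]
  simp only [Matrix.conjTranspose_mul, Matrix.mul_assoc, Matrix.mul_sum]

theorem sum_traceForm_sub_self [DecidableEq m] (hA : ∑ i, A i * ρ * (A i)ᴴ = ρ)
    (hB : ∑ i, (B i)ᴴ * B i = 1) :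
    ∑ i, traceForm ρ (X * A i - B i * mixedTransfer B A X)
        (X * A i - B i * mixedTransfer B A X) =
      traceForm ρ X X - traceForm ρ (mixedTransfer B A X) (mixedTransfer B A X) := by
  simp only [map_sub, LinearMap.sub_apply, Finset.sum_sub_distrib, sum_traceForm_mul_right hA,
    sum_traceForm_mul_left hB, sum_traceForm_mul_right_left, sum_traceForm_mul_left_right]
  ring

theorem traceForm_mixedTransfer_le [DecidableEq m] (hρ : ρ.PosDef)
    (hA : ∑ i, A i * ρ * (A i)ᴴ = ρ) (hB : ∑ i, (B i)ᴴ * B i = 1) :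
    traceForm ρ (mixedTransfer B A X) (mixedTransfer B A X) ≤ traceForm ρ X X := by
  rw [← sub_nonneg, ← sum_traceForm_sub_self hA hB]
  exact Finset.sum_nonneg fun i _ => traceForm_self_nonneg hρ

theorem mul_eq_mul_mixedTransfer [DecidableEq m] (hρ : ρ.PosDef)
    (hA : ∑ i, A i * ρ * (A i)ᴴ = ρ) (hB : ∑ i, (B i)ᴴ * B i = 1)
    (h : traceForm ρ (mixedTransfer B A X) (mixedTransfer B A X) = traceForm ρ X X) (i : s) :
    X * A i = B i * mixedTransfer B A X := by
  have h0 := sum_traceForm_sub_self (X := X) hA hB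
  rw [h, sub_self, Finset.sum_eq_zero_iff_of_nonneg fun i _ => traceForm_self_nonneg hρ] at h0
  exact sub_eq_zero.1 (eq_zero_of_traceForm_self_eq_zero hρ (h0 i (Finset.mem_univ i)))

theorem mixedTransfer_conjTranspose_mul_self [DecidableEq m] (hB : ∑ i, (B i)ᴴ * B i = 1)
    (h : ∀ i, X * A i = B i * Y) : mixedTransfer A A (Xᴴ * X) = Yᴴ * Y := by
  have hi : ∀ i, (A i)ᴴ * (Xᴴ * X) * A i = Yᴴ * ((B i)ᴴ * B i) * Y := fun i => by
    calc (A i)ᴴ * (Xᴴ * X) * A i = (X * A i)ᴴ * (X * A i) := by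
          simp only [Matrix.conjTranspose_mul, Matrix.mul_assoc]
      _ = Yᴴ * ((B i)ᴴ * B i) * Y := by
          rw [h]; simp only [Matrix.conjTranspose_mul, Matrix.mul_assoc]
  rw [mixedTransfer_apply, Finset.sum_congr rfl fun i _ => hi i, ← Matrix.sum_mul,
    ← Matrix.mul_sum, hB, Matrix.mul_one]

section MeanProj

variable [DecidableEq n] {X : Matrix n n ℂ}

/-- The projection `X ↦ (Tr(ρ X) / Tr ρ) 1` onto the multiples of `1`: the limit of the powers of
the transfer matrix with right fixed point `ρ`. -/
def meanProj (ρ : Matrix n n ℂ) : Module.End ℂ (Matrix n n ℂ) :=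
  (ρ.trace⁻¹ • traceForm ρ 1).smulRight 1

theorem meanProj_apply : meanProj ρ X = (ρ.trace⁻¹ * traceForm ρ 1 X) • 1 := rfl

theorem traceForm_one_one : traceForm ρ (1 : Matrix n n ℂ) 1 = ρ.trace :=
  traceForm_self_of_mem_unitaryGroup (one_mem _)

theorem meanProj_one (hρ : ρ.trace ≠ 0) : meanProj ρ 1 = 1 := by
  rw [meanProj_apply, traceForm_one_one, inv_mul_cancel₀ hρ, one_smul]

theorem trace_meanProj (hρ : ρ.trace ≠ 0) : LinearMap.trace ℂ _ (meanProj ρ) = 1 := by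
  rw [meanProj, LinearMap.trace_smulRight, LinearMap.smul_apply, traceForm_one_one, smul_eq_mul,
    inv_mul_cancel₀ hρ]

theorem isIdempotentElem_meanProj (hρ : ρ.trace ≠ 0) : IsIdempotentElem (meanProj ρ) := by
  ext1 X
  rw [Module.End.mul_apply, meanProj_apply (X := X), map_smul, meanProj_one hρ]

theorem mixedTransfer_one (hA : ∑ i, (A i)ᴴ * A i = 1) : mixedTransfer A A 1 = 1 := by
  simpa only [mixedTransfer_apply, mul_one] using hA

theorem mixedTransfer_mul_meanProj (hA : ∑ i, (A i)ᴴ * A i = 1) :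
    mixedTransfer A A * meanProj ρ = meanProj ρ := by
  ext1 X
  rw [Module.End.mul_apply, meanProj_apply, map_smul, mixedTransfer_one hA]

theorem meanProj_mul_mixedTransfer (hA : ∑ i, A i * ρ * (A i)ᴴ = ρ) :
    meanProj ρ * mixedTransfer A A = meanProj ρ := by
  ext1 X
  rw [Module.End.mul_apply, meanProj_apply, meanProj_apply, ← sum_traceForm_mul_left_right,
    ← sum_traceForm_mul_right hA]
  simp only [mul_one, one_mul]

theorem traceForm_meanProj_right (hρ : ρ.trace ≠ 0) :
    traceForm ρ (meanProj ρ X) X = traceForm ρ (meanProj ρ X) (meanProj ρ X) := by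
  simp only [meanProj_apply, LinearMap.map_smulₛₗ₂, map_smul, traceForm_one_one, smul_eq_mul]
  field_simp

theorem traceForm_sub_meanProj_self (hρ : ρ.PosDef) (hρ0 : ρ.trace ≠ 0) :
    traceForm ρ (X - meanProj ρ X) (X - meanProj ρ X) =
      traceForm ρ X X - traceForm ρ (meanProj ρ X) (meanProj ρ X) := by
  have h := congrArg star (traceForm_meanProj_right (X := X) hρ0)
  rw [star_traceForm hρ.1, star_traceForm hρ.1] at h
  rw [map_sub, map_sub, LinearMap.sub_apply, LinearMap.sub_apply, traceForm_meanProj_right hρ0, h]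
  ring

end MeanProj

end Transfer

namespace IsInjectiveMPS

open Filter Topology

variable {d D : ℕ} {A : Fin d → Matrix (Fin D) (Fin D) ℂ} {ρ : Matrix (Fin D) (Fin D) ℂ}

theorem trace_ne_zero (hA : IsInjectiveMPS A) (hρ : ρ.PosDef) : ρ.trace ≠ 0 := by
  have : Nonempty (Fin D) := ⟨⟨0, hA.bond_pos⟩⟩
  exact hρ.trace_pos.ne'

theorem norm_lt_one_of_hasEigenvalue (hA : IsInjectiveMPS A) (hρ : ρ.PosDef)
    (hf : ∑ s, A s * ρ * (A s)ᴴ = ρ) {μ : ℂ}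
    (hμ : (mixedTransfer A A - meanProj ρ).HasEigenvalue μ) : ‖μ‖ < 1 := by
  have hρ0 := hA.trace_ne_zero hρ
  rcases eq_or_ne μ 0 with rfl | h0
  · rw [norm_zero]; exact one_pos
  obtain ⟨X, hX⟩ := hμ.exists_hasEigenvector
  have hEX := hX.apply_eq_smul
  have hPX : meanProj ρ X = 0 := by
    have h := congrArg (meanProj ρ) hEX
    rw [← Module.End.mul_apply, mul_sub, meanProj_mul_mixedTransfer hf,
      (isIdempotentElem_meanProj hρ0).eq, sub_self, LinearMap.zero_apply, map_smul] at h
    exact (smul_eq_zero.1 h.symm).resolve_left h0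
  rw [LinearMap.sub_apply, hPX, sub_zero] at hEX
  rcases hA.gap μ X hX.2 hEX with h | ⟨-, a, rfl⟩
  · exact h
  · rw [map_smul, meanProj_one hρ0] at hPX
    exact absurd hPX hX.2

theorem tendsto_linearMap_pow {W : Type*} [AddCommGroup W] [Module ℂ W] [TopologicalSpace W]
    [IsTopologicalAddGroup W] [ContinuousSMul ℂ W] (hA : IsInjectiveMPS A) (hρ : ρ.PosDef)
    (hf : ∑ s, A s * ρ * (A s)ᴴ = ρ) (φ : Module.End ℂ (Matrix (Fin D) (Fin D) ℂ) →ₗ[ℂ] W) :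
    Tendsto (fun n : ℕ => φ (mixedTransfer A A ^ n)) atTop (𝓝 (φ (meanProj ρ))) :=
  TiltedExp.tendsto_linearMap_pow (mixedTransfer_mul_meanProj hA.left_canonical)
    (meanProj_mul_mixedTransfer hf) (isIdempotentElem_meanProj (hA.trace_ne_zero hρ))
    (fun _ => hA.norm_lt_one_of_hasEigenvalue hρ hf) φ

theorem tendsto_pow_apply (hA : IsInjectiveMPS A) (hρ : ρ.PosDef)
    (hf : ∑ s, A s * ρ * (A s)ᴴ = ρ) (X : Matrix (Fin D) (Fin D) ℂ) :
    Tendsto (fun n : ℕ => (mixedTransfer A A ^ n) X) atTop (𝓝 (meanProj ρ X)) :=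
  hA.tendsto_linearMap_pow hρ hf (LinearMap.applyₗ X)

theorem tendsto_trace_pow (hA : IsInjectiveMPS A) :
    Tendsto (fun n : ℕ => LinearMap.trace ℂ _ (mixedTransfer A A ^ n)) atTop (𝓝 1) := by
  obtain ⟨ρ, hρ, hf⟩ := hA.right_canonical
  rw [← trace_meanProj (hA.trace_ne_zero hρ)]
  exact hA.tendsto_linearMap_pow hρ hf (LinearMap.trace ℂ _)

theorem exists_eq_smul_one_of_pow_apply_eq (hA : IsInjectiveMPS A) {n : ℕ} (hn : 0 < n)
    {X : Matrix (Fin D) (Fin D) ℂ} (hX : (mixedTransfer A A ^ n) X = X) :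
    ∃ a : ℂ, X = a • (1 : Matrix (Fin D) (Fin D) ℂ) := by
  obtain ⟨ρ, hρ, hf⟩ := hA.right_canonical
  have hfix : ∀ k : ℕ, X = (mixedTransfer A A ^ (n * k)) X := fun k => by
    rw [pow_mul, Module.End.coe_pow]
    exact (Function.iterate_fixed hX k).symm
  exact ⟨_, tendsto_nhds_unique (tendsto_const_nhds.congr hfix)
    ((hA.tendsto_pow_apply hρ hf X).comp (tendsto_id.nsmul_atTop hn))⟩

/-- `Eⁿ V` converges to the projection `P V`, which is unitary as well; hence `V` and `P V` have
the same norm, and `V = P V` is a multiple of `1`. -/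
theorem phaseEq_one_of_forall_pow_mem_unitary (hA : IsInjectiveMPS A)
    {V : Matrix (Fin D) (Fin D) ℂ}
    (hV : ∀ n, (mixedTransfer A A ^ n) V ∈ Matrix.unitaryGroup (Fin D) ℂ) : PhaseEq V 1 := by
  obtain ⟨ρ, hρ, hf⟩ := hA.right_canonical
  have hρ0 := hA.trace_ne_zero hρ
  have hPV : meanProj ρ V ∈ Matrix.unitaryGroup (Fin D) ℂ :=
    isClosed_unitary.mem_of_tendsto (hA.tendsto_pow_apply hρ hf V) (Eventually.of_forall hV)
  have hV0 : V ∈ Matrix.unitaryGroup (Fin D) ℂ := hV 0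
  have hsub : traceForm ρ (V - meanProj ρ V) (V - meanProj ρ V) = 0 := by
    rw [traceForm_sub_meanProj_self hρ hρ0, traceForm_self_of_mem_unitaryGroup hPV,
      traceForm_self_of_mem_unitaryGroup hV0, sub_self]
  exact .of_eq_smul hV0 (one_mem _)
    (sub_eq_zero.1 (eq_zero_of_traceForm_self_eq_zero hρ hsub))

end IsInjectiveMPS

/-! ### Chains of transfer matrices and the fundamental theorem -/

section Chain

variable {m n s : Type*} [Fintype m] [Fintype n] [Fintype s]

theorem trace_mulLeft_comp_mulRight (C : Matrix m m ℂ)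
    (E : Matrix n n ℂ) :
    LinearMap.trace ℂ _ (mulLeftLinearMap n ℂ C ∘ₗ mulRightLinearMap m ℂ E) =
      C.trace * E.trace := by
  classical
  rw [LinearMap.trace_eq_matrix_trace ℂ (Matrix.stdBasis ℂ m n), Matrix.trace,
    Fintype.sum_prod_type, Matrix.trace, Matrix.trace, Finset.sum_mul_sum]
  refine Finset.sum_congr rfl fun i _ => Finset.sum_congr rfl fun j _ => ?_
  rw [Matrix.diag_apply, LinearMap.toMatrix_apply, Matrix.stdBasis_eq_single]
  simp [Matrix.stdBasis, Matrix.mul_apply, Matrix.single_apply, ite_and]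

/-- The composition of the mixed transfer matrices of the first `k` sites, where the tensor `B j`
sits at site `j`. -/
def mixedChain (B : ℕ → s → Matrix m m ℂ) (A : s → Matrix n n ℂ) :
    ℕ → Module.End ℂ (Matrix m n ℂ)
  | 0 => 1
  | k + 1 => mixedTransfer (B k) A * mixedChain B A k

section

variable (B : ℕ → s → Matrix m m ℂ) (A : s → Matrix n n ℂ)

theorem mixedChain_add (k l : ℕ) :
    mixedChain B A (k + l) = mixedChain (fun j => B (j + k)) A l * mixedChain B A k := by
  induction l with
  | zero => rw [add_zero, mixedChain, one_mul]
  | succ l ih => rw [← add_assoc, mixedChain, ih, mixedChain, mul_assoc, add_comm k l]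

theorem mixedChain_mul {L : ℕ} (hB : Function.Periodic B L) (k : ℕ) :
    mixedChain B A (k * L) = mixedChain B A L ^ k := by
  induction k with
  | zero => rw [zero_mul, pow_zero, mixedChain]
  | succ k ih => rw [Nat.succ_mul, add_comm, mixedChain_add, pow_succ, ← ih, funext hB]

theorem mixedChain_const (k : ℕ) : mixedChain (fun _ => A) A k = mixedTransfer A A ^ k := by
  induction k with
  | zero => rfl
  | succ k ih => rw [mixedChain, ih, pow_succ']

theorem mixedChain_eq_sum [DecidableEq m] [DecidableEq n] (k : ℕ) :
    mixedChain B A k = ∑ σ : Fin k → s,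
      mulLeftLinearMap n ℂ ((List.ofFn fun i : Fin k => B i (σ i)).prod)ᴴ ∘ₗ
        mulRightLinearMap m ℂ (List.ofFn fun i => A (σ i)).prod := by
  induction k with
  | zero => ext1 X; simp [mixedChain]
  | succ k ih =>
    ext1 X
    rw [mixedChain, ih, Module.End.mul_apply, LinearMap.sum_apply, LinearMap.sum_apply, map_sum,
      ← (Fin.snocEquiv fun _ => s).sum_comp, Fintype.sum_prod_type_right]
    refine Finset.sum_congr rfl fun σ _ => ?_
    rw [mixedTransfer_apply]
    refine Finset.sum_congr rfl fun i _ => ?_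
    simp only [LinearMap.comp_apply, mulLeftLinearMap_apply, mulRightLinearMap_apply,
      Fin.snocEquiv, Equiv.coe_fn_mk, List.ofFn_succ', Fin.snoc_castSucc, Fin.snoc_last,
      List.concat_eq_append, List.prod_append, List.prod_singleton, Fin.val_last,
      Fin.val_castSucc, Matrix.conjTranspose_mul, Matrix.mul_assoc]

theorem trace_mixedChain [DecidableEq m] [DecidableEq n] (k : ℕ) :
    LinearMap.trace ℂ _ (mixedChain B A k) = ∑ σ : Fin k → s,
      star (List.ofFn fun i : Fin k => B i (σ i)).prod.trace *
        (List.ofFn fun i => A (σ i)).prod.trace := by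
  simp only [mixedChain_eq_sum, map_sum, trace_mulLeft_comp_mulRight, Matrix.trace_conjTranspose]

end

variable [DecidableEq m] {A : s → Matrix n n ℂ} {B : ℕ → s → Matrix m m ℂ} {ρ : Matrix n n ℂ}
  {X : ℕ → Matrix m n ℂ}

/-- Along the chain the norm of an eigenvector decreases, but it does not decay from one period
to the next. Hence it is constant, which forces the intertwining relation. -/
theorem exists_intertwiner_of_hasEigenvalue_mixedChain (hρ : ρ.PosDef)
    (hA : ∑ i, A i * ρ * (A i)ᴴ = ρ) (hB : ∀ j, ∑ i, (B j i)ᴴ * B j i = 1) {L : ℕ} (hL : 1 ≤ L)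
    (hper : Function.Periodic B L) {μ : ℂ} (hμ : (mixedChain B A L).HasEigenvalue μ)
    (hμ1 : 1 ≤ ‖μ‖) :
    ∃ X : ℕ → Matrix m n ℂ, X 0 ≠ 0 ∧ X L = μ • X 0 ∧ ‖μ‖ = 1 ∧
      ∀ j i, X j * A i = B j i * X (j + 1) := by
  obtain ⟨X₀, hX₀⟩ := hμ.exists_hasEigenvector
  obtain ⟨X, hX⟩ : ∃ X : ℕ → Matrix m n ℂ, ∀ j, X j = mixedChain B A j X₀ := ⟨_, fun _ => rfl⟩
  have hX0 : X 0 = X₀ := hX 0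
  have hXsucc : ∀ j, mixedTransfer (B j) A (X j) = X (j + 1) := fun j => by rw [hX, hX]; rfl
  have hperiod : ∀ k, X (k * L) = μ ^ k • X₀ := fun k => by
    rw [hX, mixedChain_mul B A hper, hX₀.pow_apply]
  have hanti : Antitone fun j => traceForm ρ (X j) (X j) :=
    antitone_nat_of_succ_le fun j => hXsucc j ▸ traceForm_mixedTransfer_le hρ hA (hB j)
  have hge : ∀ k, traceForm ρ X₀ X₀ ≤ traceForm ρ (X (k * L)) (X (k * L)) := fun k => by
    rw [hperiod, traceForm_smul_smul]
    refine le_mul_of_one_le_left (traceForm_self_nonneg hρ) ?_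
    rw [← Complex.ofReal_one, Complex.real_le_real, norm_pow]
    exact one_le_pow₀ (one_le_pow₀ hμ1)
  have hconst : ∀ j, traceForm ρ (X j) (X j) = traceForm ρ X₀ X₀ := fun j =>
    le_antisymm (hX0 ▸ hanti (Nat.zero_le j))
      ((hge j).trans (hanti (Nat.le_mul_of_pos_right j hL)))
  have hnorm : ((‖μ‖ ^ 2 : ℝ) : ℂ) = 1 := by
    refine mul_right_cancel₀ (mt (eq_zero_of_traceForm_self_eq_zero hρ) hX₀.2) ?_
    rw [← traceForm_smul_smul, one_mul, ← pow_one μ, ← hperiod, hconst]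
  refine ⟨X, hX0 ▸ hX₀.2, ?_, ?_, fun j i => ?_⟩
  · rw [hX0, ← one_mul L, hperiod, pow_one]
  · exact (pow_eq_one_iff_of_nonneg (norm_nonneg μ) two_ne_zero).1 (by exact_mod_cast hnorm)
  · rw [← hXsucc]
    exact mul_eq_mul_mixedTransfer hρ hA (hB j) (by rw [hXsucc, hconst, hconst]) i

theorem mixedTransfer_pow_conjTranspose_mul_self (hB : ∀ j, ∑ i, (B j i)ᴴ * B j i = 1)
    (hX : ∀ j i, X j * A i = B j i * X (j + 1)) (j : ℕ) :
    (mixedTransfer A A ^ j) ((X 0)ᴴ * X 0) = (X j)ᴴ * X j := by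
  induction j with
  | zero => rw [pow_zero, Module.End.one_apply]
  | succ j ih =>
    rw [pow_succ', Module.End.mul_apply, ih, mixedTransfer_conjTranspose_mul_self (hB j) (hX j)]

end Chain

theorem exists_pos_of_conjTranspose_mul_self_eq_smul_one {n : Type*} [Fintype n] [DecidableEq n]
    {X : Matrix n n ℂ} {a : ℂ} (hX : X ≠ 0) (h : Xᴴ * X = a • 1) : ∃ r : ℝ, 0 < r ∧ a = r := by
  have : Nonempty n := not_isEmpty_iff.1 fun _ => hX (Subsingleton.elim _ _)
  have ha : 0 ≤ a := by
    simpa [h] using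
      (Matrix.posSemidef_conjTranspose_mul_self X).diag_nonneg (i := Classical.arbitrary n)
  have ha0 : a ≠ 0 := by
    rintro rfl
    exact hX (Matrix.conjTranspose_mul_self_eq_zero.1 (h.trans (zero_smul ℂ _)))
  obtain ⟨hre, him⟩ := Complex.pos_iff.1 (lt_of_le_of_ne ha ha0.symm)
  exact ⟨a.re, hre, Complex.ext rfl (by rw [Complex.ofReal_im, him])⟩

theorem inv_sqrt_smul_mem_unitaryGroup {n : Type*} [Fintype n] [DecidableEq n]
    {X : Matrix n n ℂ} {r : ℝ} (hr : 0 < r) (h : Xᴴ * X = (r : ℂ) • 1) :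
    ((√r)⁻¹ : ℂ) • X ∈ Matrix.unitaryGroup n ℂ := by
  rw [Matrix.mem_unitaryGroup_iff', star_smul, Matrix.star_eq_conjTranspose, Matrix.smul_mul,
    Matrix.mul_smul, smul_smul, h, smul_smul, ← Complex.ofReal_inv, Complex.star_def,
    Complex.conj_ofReal, ← Complex.ofReal_mul, ← Complex.ofReal_mul, ← mul_inv,
    Real.mul_self_sqrt hr.le, inv_mul_cancel₀ hr.ne', Complex.ofReal_one, one_smul]

section FundamentalTheorem

open Filter

variable {d D : ℕ} {A : Fin d → Matrix (Fin D) (Fin D) ℂ}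
  {B : ℕ → Fin d → Matrix (Fin D) (Fin D) ℂ} {L : ℕ}

theorem IsInjectiveMPS.exists_conjTranspose_mul_self_eq (hA : IsInjectiveMPS A) (hL : 1 ≤ L)
    (hB : ∀ j, ∑ i, (B j i)ᴴ * B j i = 1) {X : ℕ → Matrix (Fin D) (Fin D) ℂ} {μ : ℂ}
    (hμ : ‖μ‖ = 1) (hXL : X L = μ • X 0) (hX : ∀ j i, X j * A i = B j i * X (j + 1)) :
    ∃ a : ℂ, ∀ j, (X j)ᴴ * X j = a • 1 := by
  have hE := mixedTransfer_pow_conjTranspose_mul_self hB hX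
  have hfix : (X L)ᴴ * X L = (X 0)ᴴ * X 0 := by
    rw [hXL, Matrix.conjTranspose_smul, Matrix.smul_mul, Matrix.mul_smul, smul_smul,
      Complex.star_def, Complex.conj_mul', hμ, Complex.ofReal_one, one_pow, one_smul]
  obtain ⟨a, ha⟩ := hA.exists_eq_smul_one_of_pow_apply_eq hL ((hE L).trans hfix)
  refine ⟨a, fun j => ?_⟩
  rw [← hE, ha, map_smul, Module.End.coe_pow,
    Function.iterate_fixed (mixedTransfer_one hA.left_canonical) j]

/-- If all eigenvalues were inside the open unit disc, the overlaps `Tr ℰᵏ` of the two families of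
states would decay, whereas those of `A` with itself tend to `1`. -/
theorem IsInjectiveMPS.exists_hasEigenvalue_mixedChain (hA : IsInjectiveMPS A) (hL : 1 ≤ L)
    (hper : Function.Periodic B L)
    (hstate : ∀ k, 1 ≤ k → ∃ c : Circle, ∀ σ : Fin (k * L) → Fin d,
      (List.ofFn fun i : Fin (k * L) => B i (σ i)).prod.trace = c * mpsState A (k * L) σ) :
    ∃ μ, (mixedChain B A L).HasEigenvalue μ ∧ 1 ≤ ‖μ‖ := by
  have hoverlap : ∀ k, 1 ≤ k → ‖LinearMap.trace ℂ _ (mixedChain B A L ^ k)‖ =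
      ‖LinearMap.trace ℂ _ (mixedTransfer A A ^ (k * L))‖ := fun k hk => by
    obtain ⟨c, hc⟩ := hstate k hk
    rw [← mixedChain_mul B A hper, ← mixedChain_const, trace_mixedChain, trace_mixedChain]
    simp only [hc, star_mul', mul_assoc, ← Finset.mul_sum, norm_mul, norm_star, Circle.norm_coe,
      one_mul]
    rfl
  by_contra! hdecay
  have h0 := (tendsto_linearMap_pow_zero hdecay (LinearMap.trace ℂ _)).norm
  have h1 := (hA.tendsto_trace_pow.comp (tendsto_id.atTop_mul_const' (show 0 < L from hL))).norm
  have h := tendsto_nhds_unique h0 (h1.congr' (by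
    filter_upwards [eventually_ge_atTop 1] with k hk using (hoverlap k hk).symm))
  exact zero_ne_one (by simpa only [norm_zero, norm_one] using h)

/-- Fundamental theorem of injective MPS, with site-dependent tensors on one side. -/
theorem IsInjectiveMPS.exists_unitary_of_state_eq (hA : IsInjectiveMPS A) (hL : 1 ≤ L)
    (hB : ∀ j, ∑ i, (B j i)ᴴ * B j i = 1) (hper : Function.Periodic B L)
    (hstate : ∀ k, 1 ≤ k → ∃ c : Circle, ∀ σ : Fin (k * L) → Fin d,
      (List.ofFn fun i : Fin (k * L) => B i (σ i)).prod.trace = c * mpsState A (k * L) σ) :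
    ∃ v : ℕ → Matrix (Fin D) (Fin D) ℂ, (∀ j, v j ∈ Matrix.unitaryGroup (Fin D) ℂ) ∧
      ∀ j i, B j i = (v j)ᴴ * A i * v (j + 1) := by
  obtain ⟨ρ, hρ, hf⟩ := hA.right_canonical
  obtain ⟨μ, hμ, hμ1⟩ := hA.exists_hasEigenvalue_mixedChain hL hper hstate
  obtain ⟨X, hX0, hXL, hμ1, hX⟩ :=
    exists_intertwiner_of_hasEigenvalue_mixedChain hρ hf hB hL hper hμ hμ1
  obtain ⟨a, ha⟩ := hA.exists_conjTranspose_mul_self_eq hL hB hμ1 hXL hX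
  obtain ⟨r, hr, rfl⟩ := exists_pos_of_conjTranspose_mul_self_eq_smul_one hX0 (ha 0)
  let W j := ((√r)⁻¹ : ℂ) • X j
  have hW : ∀ j, W j ∈ Matrix.unitaryGroup (Fin D) ℂ := fun j =>
    inv_sqrt_smul_mem_unitaryGroup hr (ha j)
  have hWA : ∀ j i, W j * A i = B j i * W (j + 1) := fun j i => by
    simp only [W, Matrix.smul_mul, Matrix.mul_smul, hX]
  refine ⟨fun j => (W j)ᴴ, fun j => Unitary.star_mem (hW j), fun j i => ?_⟩
  rw [Matrix.conjTranspose_conjTranspose, hWA, Matrix.mul_assoc,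
    mul_conjTranspose_self_of_mem (hW _), mul_one]

end FundamentalTheorem

/-! ### Pushing on-site operators to the bonds -/

section Push

variable {s n : Type*} [Fintype s]

/-- The tensor `u · A` obtained by acting with `u` on the physical index of `A`. -/
def act (u : Matrix s s ℂ) (A : s → Matrix n n ℂ) : s → Matrix n n ℂ :=
  fun i => ∑ i', u i i' • A i'

variable {u u' : Matrix s s ℂ} {A : s → Matrix n n ℂ}

theorem act_mul (u u' : Matrix s s ℂ) (A : s → Matrix n n ℂ) :
    act (u * u') A = act u (act u' A) := by
  funext i
  simp only [act, Matrix.mul_apply, Finset.sum_smul, Finset.smul_sum, smul_smul]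
  exact Finset.sum_comm

theorem act_one [DecidableEq s] (A : s → Matrix n n ℂ) : act 1 A = A := by
  funext i
  simp only [act, Matrix.one_apply, ite_smul, one_smul, zero_smul, Finset.sum_ite_eq,
    Finset.mem_univ, if_true]

variable [Fintype n]

theorem act_smul_mul_mul (u : Matrix s s ℂ) (A : s → Matrix n n ℂ) (c : ℂ) (X Y : Matrix n n ℂ) :
    act u (fun i => c • (X * A i * Y)) = fun i => c • (X * act u A i * Y) := by
  funext i
  simp only [act, Finset.mul_sum, Finset.sum_mul, Finset.smul_sum]
  refine Finset.sum_congr rfl fun i' _ => ?_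
  rw [Matrix.mul_smul, Matrix.smul_mul, smul_comm]

theorem act_mul_eq {c c' : ℂ} {p q p' q' : Matrix n n ℂ}
    (h : act u A = fun i => c • (pᴴ * A i * q)) (h' : act u' A = fun i => c' • (p'ᴴ * A i * q')) :
    act (u * u') A = fun i => (c' * c) • ((p * p')ᴴ * A i * (q * q')) := by
  rw [act_mul, h', act_smul_mul_mul, h]
  simp only [Matrix.mul_smul, Matrix.smul_mul, smul_smul, Matrix.conjTranspose_mul,
    Matrix.mul_assoc]

theorem act_left_canonical [DecidableEq s] [DecidableEq n] (hu : u ∈ Matrix.unitaryGroup s ℂ)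
    (hA : ∑ i, (A i)ᴴ * A i = 1) : ∑ i, (act u A i)ᴴ * act u A i = 1 := by
  have horth : ∀ a b, ∑ i, star (u i a) * u i b = if a = b then 1 else 0 := fun a b => by
    simpa only [Matrix.mul_apply, Matrix.one_apply, Matrix.star_apply] using
      congrFun (congrFun (Matrix.mem_unitaryGroup_iff'.1 hu) a) b
  have hexpand : ∀ i, (act u A i)ᴴ * act u A i =
      ∑ a, ∑ b, (star (u i a) * u i b) • ((A a)ᴴ * A b) := fun i => by
    simp only [act, Matrix.conjTranspose_sum, Matrix.conjTranspose_smul, Finset.sum_mul_sum,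
      Matrix.smul_mul, Matrix.mul_smul, smul_smul, mul_comm]
  rw [Finset.sum_congr rfl fun i _ => hexpand i, Finset.sum_comm, ← hA]
  refine Finset.sum_congr rfl fun a _ => ?_
  rw [Finset.sum_comm]
  simp only [← Finset.sum_smul, horth, ite_smul, one_smul, zero_smul, Finset.sum_ite_eq,
    Finset.mem_univ, if_true]

/-- The site operator `u` is pushed through the tensor `A` to the neighbouring bonds:
`u · A ≐ p† A q`. -/
def PushSite (u : Matrix s s ℂ) (A : s → Matrix n n ℂ) (p q : Matrix n n ℂ) : Prop :=
  ∃ c : Circle, act u A = fun i => (c : ℂ) • (pᴴ * A i * q)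

namespace PushSite

variable {p q p' q' : Matrix n n ℂ}

theorem mul (h : PushSite u A p q) (h' : PushSite u' A p' q') :
    PushSite (u * u') A (p * p') (q * q') := by
  obtain ⟨c, hc⟩ := h
  obtain ⟨c', hc'⟩ := h'
  exact ⟨c' * c, by simpa only [Circle.coe_mul] using act_mul_eq hc hc'⟩

theorem pow [DecidableEq s] [DecidableEq n] (h : PushSite u A p q) (k : ℕ) :
    PushSite (u ^ k) A (p ^ k) (q ^ k) := by
  induction k with
  | zero => exact ⟨1, by simp [act_one]⟩
  | succ k ih => simpa only [pow_succ] using ih.mul h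

theorem congr_right {D : ℕ} {A : s → Matrix (Fin D) (Fin D) ℂ} {p q q' : Matrix (Fin D) (Fin D) ℂ}
    (h : PushSite u A p q) (hq : PhaseEq q q') : PushSite u A p q' := by
  obtain ⟨c, hc⟩ := h
  obtain ⟨c', rfl⟩ := hq
  exact ⟨c * c', by simp only [hc, Matrix.mul_smul, smul_smul, Circle.coe_mul]⟩

theorem of_mul_eq [DecidableEq n] (hp : p ∈ Matrix.unitaryGroup n ℂ) (c : Circle)
    (h : ∀ i, p * act u A i = (c : ℂ) • (A i * q)) : PushSite u A p q := by
  refine ⟨c, funext fun i => ?_⟩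
  rw [Matrix.mul_assoc, ← Matrix.mul_smul, ← h, ← Matrix.mul_assoc,
    conjTranspose_mul_self_of_mem hp, one_mul]

theorem exists_mul_eq_smul_mul [DecidableEq n] (h : PushSite u A p q) (h' : PushSite u A p' q')
    (hp' : p' ∈ Matrix.unitaryGroup n ℂ) (hq : q ∈ Matrix.unitaryGroup n ℂ) :
    ∃ c : Circle, ∀ i, p' * pᴴ * A i = (c : ℂ) • (A i * (q' * qᴴ)) := by
  obtain ⟨c, hc⟩ := h
  obtain ⟨c', hc'⟩ := h'
  refine ⟨c⁻¹ * c', fun i => ?_⟩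
  have heq : pᴴ * A i * q = ((c⁻¹ * c' : Circle) : ℂ) • (p'ᴴ * A i * q') := by
    rw [Circle.coe_mul, mul_smul, ← congrFun (hc.symm.trans hc') i, smul_smul, ← Circle.coe_mul,
      inv_mul_cancel, Circle.coe_one, one_smul]
  calc p' * pᴴ * A i = p' * (pᴴ * A i * q) * qᴴ := by
        simp only [Matrix.mul_assoc, mul_conjTranspose_self_of_mem hq, mul_one]
    _ = ((c⁻¹ * c' : Circle) : ℂ) • (p' * p'ᴴ * (A i * (q' * qᴴ))) := by
        rw [heq, Matrix.mul_smul, Matrix.smul_mul]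
        simp only [Matrix.mul_assoc]
    _ = _ := by rw [mul_conjTranspose_self_of_mem hp', one_mul]

theorem commutator_eq [DecidableEq n] (hA : A ≠ 0) (huu' : Commute u u') (h : PushSite u A p q)
    (h' : PushSite u' A p' q') (hp : p ∈ Matrix.unitaryGroup n ℂ)
    (hp' : p' ∈ Matrix.unitaryGroup n ℂ) (hq : q ∈ Matrix.unitaryGroup n ℂ)
    (hq' : q' ∈ Matrix.unitaryGroup n ℂ) {α β : Circle} (hα : p * p' = (α : ℂ) • (p' * p))
    (hβ : q * q' = (β : ℂ) • (q' * q)) : α = β := by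
  obtain ⟨i, hi⟩ := Function.ne_iff.1 hA
  obtain ⟨c, hc⟩ := h
  obtain ⟨c', hc'⟩ := h'
  set Y := (p' * p)ᴴ * A i * (q' * q)
  have hY : Y ≠ 0 := conjTranspose_mul_mul_ne_zero (mul_mem hp' hp) (mul_mem hq' hq) hi
  have heq : (c' * c : ℂ) • (star (α : ℂ) * β) • Y = (c * c' : ℂ) • Y := by
    calc (c' * c : ℂ) • (star (α : ℂ) * β) • Y
        = act (u * u') A i := by
          rw [congrFun (act_mul_eq hc hc') i, hα, hβ, Matrix.conjTranspose_smul, Matrix.smul_mul,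
            Matrix.smul_mul, Matrix.mul_smul, smul_smul (star (α : ℂ))]
      _ = (c * c' : ℂ) • Y := by rw [huu'.eq, act_mul_eq hc' hc]
  have hone : star (α : ℂ) * β = 1 := by
    refine smul_left_injective ℂ hY ?_
    refine smul_right_injective _ (mul_ne_zero c.coe_ne_zero c'.coe_ne_zero) ?_
    simpa only [one_smul, mul_comm (c' : ℂ)] using heq
  refine Circle.ext ?_
  rw [← mul_one (α : ℂ), ← hone, ← mul_assoc, Complex.star_def, Complex.mul_conj,
    Circle.normSq_coe, Complex.ofReal_one, one_mul]

end PushSite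

/-- The unitaries `v j` push the site operators `W j` through the tensor `A`:
`W_j · A ≐ v_j† A v_{j+1}`. -/
structure IsPush [DecidableEq n] (W : ℕ → Matrix s s ℂ) (A : s → Matrix n n ℂ)
    (v : ℕ → Matrix n n ℂ) : Prop where
  unitary : ∀ j, v j ∈ Matrix.unitaryGroup n ℂ
  push : ∀ j, PushSite (W j) A (v j) (v (j + 1))

namespace IsPush

variable [DecidableEq n] {W W' : ℕ → Matrix s s ℂ} {v v' : ℕ → Matrix n n ℂ}

theorem mul (h : IsPush W A v) (h' : IsPush W' A v') :
    IsPush (fun j => W j * W' j) A (fun j => v j * v' j) where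
  unitary j := mul_mem (h.unitary j) (h'.unitary j)
  push j := (h.push j).mul (h'.push j)

theorem pow [DecidableEq s] (h : IsPush W A v) (k : ℕ) :
    IsPush (fun j => W j ^ k) A (fun j => v j ^ k) where
  unitary j := pow_mem (h.unitary j) k
  push j := (h.push j).pow k

theorem shift (h : IsPush W A v) (k : ℕ) :
    IsPush (fun j => W (j + k)) A (fun j => v (j + k)) where
  unitary j := h.unitary (j + k)
  push j := by simpa only [add_right_comm] using h.push (j + k)

theorem exists_prod_act_eq (h : IsPush W A v) (k : ℕ) : ∃ c : Circle, ∀ σ : Fin k → s,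
    (List.ofFn fun i : Fin k => act (W i) A (σ i)).prod =
      (c : ℂ) • ((v 0)ᴴ * (List.ofFn fun i => A (σ i)).prod * v k) := by
  induction k with
  | zero => exact ⟨1, fun σ => by simp [conjTranspose_mul_self_of_mem (h.unitary 0)]⟩
  | succ k ih =>
    obtain ⟨c, hc⟩ := ih
    obtain ⟨c', hc'⟩ := h.push k
    refine ⟨c * c', fun σ => ?_⟩
    have hinit := hc fun i => σ i.castSucc
    simp only [List.ofFn_succ', List.concat_eq_append, List.prod_append, List.prod_singleton,
      Fin.val_last, Fin.val_castSucc]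
    rw [hinit, hc', Matrix.smul_mul, Matrix.mul_smul, smul_smul, Circle.coe_mul]
    congr 1
    calc _ = (v 0)ᴴ * (List.ofFn fun i : Fin k => A (σ i.castSucc)).prod *
          (v k * (v k)ᴴ) * A (σ (Fin.last k)) * v (k + 1) := by simp only [Matrix.mul_assoc]
      _ = _ := by
        rw [mul_conjTranspose_self_of_mem (h.unitary k), mul_one]
        simp only [Matrix.mul_assoc]

end IsPush
end Push

section PushMPS

variable {d D : ℕ} {A : Fin d → Matrix (Fin D) (Fin D) ℂ}

theorem chainOp_mulVec_mpsState {k : ℕ} (u : Fin k → Matrix (Fin d) (Fin d) ℂ)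
    (A : Fin d → Matrix (Fin D) (Fin D) ℂ) (σ : Fin k → Fin d) :
    (chainOp u *ᵥ mpsState A k) σ = (List.ofFn fun i => act (u i) A (σ i)).prod.trace := by
  have hexpand := (MultilinearMap.mkPiAlgebraFin ℂ k (Matrix (Fin D) (Fin D) ℂ)).map_sum
    fun i s' => u i (σ i) s' • A s'
  simp only [MultilinearMap.map_smul_univ, MultilinearMap.mkPiAlgebraFin_apply] at hexpand
  simp only [act, hexpand, Matrix.trace_sum, Matrix.trace_smul, smul_eq_mul, Matrix.mulVec,
    dotProduct, chainOp, mpsState]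

theorem mixedTransfer_phaseEq (hA : ∑ i, (A i)ᴴ * A i = 1) {V V' : Matrix (Fin D) (Fin D) ℂ}
    {c : Circle} (h : ∀ i, V * A i = (c : ℂ) • (A i * V')) : PhaseEq (mixedTransfer A A V) V' := by
  refine ⟨c, ?_⟩
  simp only [mixedTransfer_apply, Matrix.mul_assoc, h, Matrix.mul_smul, ← Finset.smul_sum]
  simp only [← Matrix.mul_assoc, ← Finset.sum_mul, hA, one_mul]

/-- The transfer matrix maps `v'₀ v₀†` to `v'₁ v₁†`, then to `v'₂ v₂†` and so on, up to phases;
all of these are unitary, although a power of the transfer matrix contracts everything but `1`. -/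
theorem IsPush.phaseEq {W : ℕ → Matrix (Fin d) (Fin d) ℂ} {v v' : ℕ → Matrix (Fin D) (Fin D) ℂ}
    (hA : IsInjectiveMPS A) (h : IsPush W A v) (h' : IsPush W A v') (j : ℕ) :
    PhaseEq (v' j) (v j) := by
  have hw : ∀ i, v' i * (v i)ᴴ ∈ Matrix.unitaryGroup (Fin D) ℂ := fun i =>
    mul_mem (h'.unitary i) (Unitary.star_mem (h.unitary i))
  have hpow : ∀ n, PhaseEq ((mixedTransfer A A ^ n) (v' j * (v j)ᴴ))
      (v' (j + n) * (v (j + n))ᴴ) := fun n => by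
    induction n with
    | zero => exact PhaseEq.refl _
    | succ n ih =>
      obtain ⟨c, hc⟩ := (h.push (j + n)).exists_mul_eq_smul_mul (h'.push (j + n))
        (h'.unitary _) (h.unitary _)
      rw [pow_succ', Module.End.mul_apply]
      exact (ih.map _).trans (mixedTransfer_phaseEq hA.left_canonical hc)
  have hone := hA.phaseEq_one_of_forall_pow_mem_unitary fun n => (hpow n).mem_unitaryGroup (hw _)
  simpa only [Matrix.mul_assoc, conjTranspose_mul_self_of_mem (h.unitary j), mul_one, one_mul]
    using hone.mul (PhaseEq.refl (v j))

end PushMPS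

/-! ### The on-site operators of the modulated symmetries -/

section OnSite

variable {d N b L : ℕ} {U : Matrix (Fin d) (Fin d) ℂ}

theorem onSite_eq_pow (N b : ℕ) (U : Matrix (Fin d) (Fin d) ℂ) (g : G N) (j : ℕ) :
    onSite N b U g j = U ^ (g.1.val * expMod b j + g.2.val * dipExpMod b j) := by
  rw [onSite, ← pow_mul, ← pow_mul, pow_add]

theorem commute_onSite (N b : ℕ) (U : Matrix (Fin d) (Fin d) ℂ) (g h : G N) (j : ℕ) :
    Commute (onSite N b U g j) (onSite N b U h j) := by
  simp only [onSite_eq_pow]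
  exact Commute.pow_pow_self U _ _

theorem onSite_mem_unitaryGroup (hU : U ∈ Matrix.unitaryGroup (Fin d) ℂ) (b : ℕ) (g : G N)
    (j : ℕ) : onSite N b U g j ∈ Matrix.unitaryGroup (Fin d) ℂ := by
  rw [onSite_eq_pow]
  exact pow_mem hU _

theorem onSite_add [NeZero N] (hU : U ^ N = 1) (b : ℕ) (g h : G N) (j : ℕ) :
    onSite N b U (g + h) j = onSite N b U g j * onSite N b U h j := by
  have hval : ∀ a c : ZMod N, U ^ (a + c).val = U ^ (a.val + c.val) := fun a c => by
    rw [ZMod.val_add, ← pow_eq_pow_mod _ hU]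
  simp only [onSite, Prod.fst_add, Prod.snd_add, hval, ← pow_mul, ← pow_add]
  ring_nf

theorem onSite_periodic (h₁ : WellDefinedOnRing U (expMod b) L)
    (h₂ : WellDefinedOnRing U (dipExpMod b) L) (g : G N) :
    Function.Periodic (fun j => onSite N b U g (j + 1)) L := fun j => by
  have hexp := h₁ (j + 1) (Nat.le_add_left 1 j)
  have hdip := h₂ (j + 1) (Nat.le_add_left 1 j)
  simp only [onSite, ← pow_mul, mul_comm _ (expMod _ _), mul_comm _ (dipExpMod _ _)]
  rw [add_right_comm j L 1, pow_mul U, pow_mul U, hexp, hdip, ← pow_mul, ← pow_mul]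

theorem onSite_exp_succ (b : ℕ) (U : Matrix (Fin d) (Fin d) ℂ) (g : ZMod N) (j : ℕ) :
    onSite N b U (g, 0) (j + 2) = onSite N b U (g, 0) (j + 1) ^ b := by
  simp only [onSite_eq_pow, ZMod.val_zero, zero_mul, add_zero, expMod, ← pow_mul,
    Nat.add_succ_sub_one]
  ring_nf

theorem onSite_dipExp_succ (b : ℕ) (U : Matrix (Fin d) (Fin d) ℂ) (g : ZMod N) (j : ℕ) :
    onSite N b U (0, g) (j + 2) =
      onSite N b U (0, g) (j + 1) ^ b * onSite N b U (g, 0) (j + 2) := by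
  simp only [onSite_eq_pow, ZMod.val_zero, zero_mul, add_zero, zero_add, expMod, dipExpMod,
    ← pow_mul, ← pow_add, Nat.add_succ_sub_one]
  ring_nf

theorem pow_eq_pow_iff_modEq_of_mem_unitaryGroup (hU : U ∈ Matrix.unitaryGroup (Fin d) ℂ)
    (m n : ℕ) : U ^ m = U ^ n ↔ m ≡ n [MOD orderOf U] := by
  obtain ⟨u, rfl⟩ := (Unitary.isUnit_coe (U := ⟨U, hU⟩) : IsUnit U)
  rw [← Units.val_pow_eq_pow_val, ← Units.val_pow_eq_pow_val, Units.val_inj,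
    pow_eq_pow_iff_modEq, orderOf_units]

theorem wellDefinedOnRing_expMod_and_dipExpMod_iff (hU : U ∈ Matrix.unitaryGroup (Fin d) ℂ)
    (hN : orderOf U = N) :
    (WellDefinedOnRing U (expMod b) L ∧ WellDefinedOnRing U (dipExpMod b) L) ↔
      (L ≡ 0 [MOD N] ∧ b ^ L ≡ 1 [MOD N]) := by
  simp only [WellDefinedOnRing, pow_eq_pow_iff_modEq_of_mem_unitaryGroup hU, hN, expMod, dipExpMod]
  constructor
  · rintro ⟨h₁, h₂⟩
    have hb : b ^ L ≡ 1 [MOD N] := by simpa using h₁ 1 le_rfl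
    have hbL : (1 + L) * b ^ L ≡ 1 [MOD N] := by simpa using h₂ 1 le_rfl
    have hL : 1 + L ≡ 1 + 0 [MOD N] := by
      simpa using ((Nat.ModEq.refl (1 + L)).mul hb).symm.trans hbL
    exact ⟨hL.add_left_cancel' 1, hb⟩
  · rintro ⟨hL, hb⟩
    have hexp : ∀ j, 1 ≤ j → b ^ (j + L - 1) ≡ b ^ (j - 1) [MOD N] := fun j hj => by
      rw [Nat.sub_add_comm hj, pow_add]
      simpa using (Nat.ModEq.refl (b ^ (j - 1))).mul hb
    exact ⟨hexp, fun j hj => by simpa using ((Nat.ModEq.refl j).add hL).mul (hexp j hj)⟩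

end OnSite

section Periodicity

variable {N b L : ℕ}

theorem coprime_of_pow_modEq_one (hL : L ≠ 0) (h : b ^ L ≡ 1 [MOD N]) : b.Coprime N := by
  have hcop : (b ^ L).Coprime N := h.gcd_eq.trans (Nat.gcd_one_left N)
  exact hcop.coprime_dvd_left (dvd_pow_self b hL)

theorem pow_mul_totient_mul_modEq_one (h : b.Coprime N) (k l : ℕ) :
    b ^ (k * N.totient * l) ≡ 1 [MOD N] := by
  rw [mul_comm k, mul_assoc, pow_mul]
  simpa only [one_pow] using (Nat.ModEq.pow_totient h).pow (k * l)

end Periodicity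

/-! ### Projective representations -/

section ProjRep

variable {n : Type*} [Fintype n] {H : Type*} [AddCommGroup H]

/-- `u` is a projective representation with cocycle `ω`. -/
def IsProjRep (u : H → Matrix n n ℂ) (ω : Z2 H) : Prop :=
  ∀ g h, u g * u h = (ω.1 g h : ℂ) • u (g + h)

variable {u : H → Matrix n n ℂ} {ω : Z2 H}

theorem IsProjRep.mul_eq_commutatorChar_smul (hu : IsProjRep u ω) (g h : H) :
    u g * u h = (Z2.commutatorChar ω h g : ℂ) • (u h * u g) := by
  rw [hu, hu, Z2.commutatorChar_apply, smul_smul, ← Circle.coe_mul, div_mul_cancel, add_comm]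

theorem exists_isProjRep [DecidableEq n] [Nonempty n] (hu : ∀ g, u g ∈ Matrix.unitaryGroup n ℂ)
    (hmul : ∀ g h, ∃ c : Circle, u g * u h = (c : ℂ) • u (g + h)) : ∃ ω, IsProjRep u ω := by
  choose ω hω using hmul
  refine ⟨⟨ω, fun g h l => Circle.ext ?_⟩, hω⟩
  refine smul_left_injective_of_mem_unitaryGroup (hu (g + h + l)) ?_
  simp only [Circle.coe_mul, mul_smul]
  rw [← hω, ← Matrix.smul_mul, ← hω, Matrix.mul_assoc, hω h l, Matrix.mul_smul, hω g, add_assoc]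

theorem IsProjRep.mk_eq_of_phaseEq {D : ℕ} [NeZero D] {u u' : H → Matrix (Fin D) (Fin D) ℂ}
    {ω ω' : Z2 H} (h : IsProjRep u ω) (h' : IsProjRep u' ω')
    (hu : ∀ g, u g ∈ Matrix.unitaryGroup (Fin D) ℂ) (hp : ∀ g, PhaseEq (u' g) (u g)) :
    H2.mk ω' = H2.mk ω := by
  refine H2.mk_eq_mk_iff.2 ?_
  ext k g
  exact PhaseEq.multiplier_eq (hp g) (hp k) (hu g) (hu k) (h'.mul_eq_commutatorChar_smul g k)
    (h.mul_eq_commutatorChar_smul g k)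

end ProjRep

/-! ### Bond unitaries of symmetric MPS -/

theorem IsInjectiveMPS.ne_zero {d D : ℕ} {A : Fin d → Matrix (Fin D) (Fin D) ℂ}
    (hA : IsInjectiveMPS A) : A ≠ 0 := by
  have : NeZero D := ⟨hA.bond_pos.ne'⟩
  rintro rfl
  simpa using hA.left_canonical

section Bond

variable {d D N b L : ℕ} {U : Matrix (Fin d) (Fin d) ℂ} {A : Fin d → Matrix (Fin D) (Fin D) ℂ}

theorem isBondUnitaries_iff {v : ℕ → G N → Matrix (Fin D) (Fin D) ℂ} :
    IsBondUnitaries N b U A v ↔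
      ∀ g, IsPush (fun j => onSite N b U g (j + 1)) A (fun j => v j g) := by
  constructor
  · refine fun h g => ⟨fun j => h.unitary j g, fun j => ?_⟩
    obtain ⟨c, hc⟩ := h.push j g
    exact ⟨c, funext hc⟩
  · refine fun h => ⟨fun j g => (h g).unitary j, fun j g => ?_⟩
    obtain ⟨c, hc⟩ := (h g).push j
    exact ⟨c, congrFun hc⟩

theorem symOp_mulVec_mpsState (h₁ : WellDefinedOnRing U (expMod b) L)
    (h₂ : WellDefinedOnRing U (dipExpMod b) L) (g : G N) (k : ℕ) (σ : Fin (k * L) → Fin d) :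
    (symOp N b L k U g *ᵥ mpsState A (k * L)) σ =
      (List.ofFn fun i : Fin (k * L) => act (onSite N b U g (i + 1)) A (σ i)).prod.trace := by
  have hmod : ∀ i, onSite N b U g (i % L + 1) = onSite N b U g (i + 1) :=
    (onSite_periodic h₁ h₂ g).map_mod_nat
  simp only [symOp, chainOp_mulVec_mpsState, hmod]

theorem IsSymmetricMPS.exists_isBondUnitaries (h : IsSymmetricMPS N b L U A) (hL : 1 ≤ L) :
    ∃ v, IsBondUnitaries N b U A v := by
  have hpush : ∀ g : G N, ∃ v : ℕ → Matrix (Fin D) (Fin D) ℂ,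
      IsPush (fun j => onSite N b U g (j + 1)) A v := fun g => by
    have hper := (onSite_periodic h.ring_exp h.ring_dipExp g).comp fun u => act u A
    obtain ⟨v, hv, hact⟩ := h.injective.exists_unitary_of_state_eq hL
      (fun j => act_left_canonical (onSite_mem_unitaryGroup h.unitary b g _)
        h.injective.left_canonical) hper fun k hk => by
        obtain ⟨c, hc⟩ := h.symmetric g k hk
        exact ⟨c, fun σ => (symOp_mulVec_mpsState h.ring_exp h.ring_dipExp g k σ).symm.trans
          (congrFun hc σ)⟩
    exact ⟨v, hv, fun j => ⟨1, funext fun i => by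
      rw [Circle.coe_one, one_smul, ← hact]⟩⟩
  choose v hv using hpush
  exact ⟨fun j g => v g j, isBondUnitaries_iff.2 hv⟩

namespace IsBondUnitaries

variable {v v' : ℕ → G N → Matrix (Fin D) (Fin D) ℂ}

theorem vE_succ (hA : IsInjectiveMPS A) (hv : IsBondUnitaries N b U A v) (j : ℕ) (g : ZMod N) :
    PhaseEq (vE v (j + 1) g) (vE v j g ^ b) := by
  have h := isBondUnitaries_iff.1 hv (g, 0)
  have hshift := h.shift 1
  simp only [add_assoc, one_add_one_eq_two, onSite_exp_succ] at hshift
  exact (h.pow b).phaseEq hA hshift j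

theorem vDE_succ (hA : IsInjectiveMPS A) (hv : IsBondUnitaries N b U A v) (j : ℕ) (g : ZMod N) :
    PhaseEq (vDE v (j + 1) g) (vDE v j g ^ b * vE v (j + 1) g) := by
  have hD := isBondUnitaries_iff.1 hv (0, g)
  have hE := (isBondUnitaries_iff.1 hv (g, 0)).shift 1
  have hshift := hD.shift 1
  simp only [add_assoc, one_add_one_eq_two] at hE hshift
  simp only [onSite_dipExp_succ] at hshift
  exact ((hD.pow b).mul hE).phaseEq hA hshift j

theorem vDE_succ' (hA : IsInjectiveMPS A) (hv : IsBondUnitaries N b U A v) (j : ℕ)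
    (g : ZMod N) : PhaseEq (vDE v (j + 1) g) (vDE v j g ^ b * vE v j g ^ b) :=
  (hv.vDE_succ hA j g).trans ((PhaseEq.refl _).mul (hv.vE_succ hA j g))

theorem phaseEq_mul [NeZero N] (hU : U ^ N = 1) (hA : IsInjectiveMPS A)
    (hv : IsBondUnitaries N b U A v) (j : ℕ) (g h : G N) :
    PhaseEq (v j g * v j h) (v j (g + h)) := by
  have hadd := isBondUnitaries_iff.1 hv (g + h)
  simp only [onSite_add hU] at hadd
  exact hadd.phaseEq hA ((isBondUnitaries_iff.1 hv g).mul (isBondUnitaries_iff.1 hv h)) j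

theorem exists_isProjRep [NeZero N] (hU : U ^ N = 1) (hA : IsInjectiveMPS A)
    (hv : IsBondUnitaries N b U A v) (j : ℕ) : ∃ ω, IsProjRep (v j) ω :=
  have : NeZero D := ⟨hA.bond_pos.ne'⟩
  TiltedExp.exists_isProjRep (hv.unitary j) (hv.phaseEq_mul hU hA j)

theorem mk_succ_eq (hA : A ≠ 0) (hv : IsBondUnitaries N b U A v) (j : ℕ) {ω ω' : Z2 (G N)}
    (h : IsProjRep (v j) ω) (h' : IsProjRep (v (j + 1)) ω') : H2.mk ω' = H2.mk ω := by
  refine H2.mk_eq_mk_iff.2 ?_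
  ext k g : 2
  have hpush := fun g => (isBondUnitaries_iff.1 hv g).push j
  exact ((hpush g).commutator_eq hA (commute_onSite N b U g k (j + 1)) (hpush k) (hv.unitary _ _)
    (hv.unitary _ _) (hv.unitary _ _) (hv.unitary _ _) (h.mul_eq_commutatorChar_smul g k)
    (h'.mul_eq_commutatorChar_smul g k)).symm

theorem mk_eq [NeZero N] (hU : U ^ N = 1) (hA : IsInjectiveMPS A)
    (hv : IsBondUnitaries N b U A v) (hv' : IsBondUnitaries N b U A v') (j : ℕ)
    {ω ω' : Z2 (G N)} (h : IsProjRep (v 0) ω) (h' : IsProjRep (v' j) ω') :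
    H2.mk ω' = H2.mk ω := by
  have : NeZero D := ⟨hA.bond_pos.ne'⟩
  induction j generalizing ω' with
  | zero =>
    exact h.mk_eq_of_phaseEq h' (hv.unitary 0) fun g =>
      (isBondUnitaries_iff.1 hv g).phaseEq hA (isBondUnitaries_iff.1 hv' g) 0
  | succ j ih =>
    obtain ⟨ω'', h''⟩ := hv'.exists_isProjRep hU hA j
    exact (hv'.mk_succ_eq hA.ne_zero j h'' h').trans (ih h'')

end IsBondUnitaries

theorem IsSymmetricMPS.pow_eq_one (h : IsSymmetricMPS N b L U A) : U ^ N = 1 := by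
  rw [← h.order, pow_orderOf_eq_one]

theorem IsSymmetricMPS.exists_hasSPTClass [NeZero N] (h : IsSymmetricMPS N b L U A) (hL : 1 ≤ L) :
    ∃ c, HasSPTClass N b U A c := by
  obtain ⟨v₀, hv₀⟩ := h.exists_isBondUnitaries hL
  obtain ⟨ω₀, hω₀⟩ := hv₀.exists_isProjRep h.pow_eq_one h.injective 0
  refine ⟨H2.mk ω₀, ⟨v₀, hv₀⟩, fun v hv j => ?_⟩
  obtain ⟨ω, hω⟩ := hv.exists_isProjRep h.pow_eq_one h.injective j
  exact ⟨ω, hω, hv₀.mk_eq h.pow_eq_one h.injective hv j hω₀ hω⟩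

namespace HasSPTClass

variable [NeZero N] {c c' : H2 (G N)}

theorem vE_mul_vDE (h : HasSPTClass N b U A c) {v : ℕ → G N → Matrix (Fin D) (Fin D) ℂ}
    (hv : IsBondUnitaries N b U A v) (j : ℕ) :
    vE v j 1 * vDE v j 1 =
      (ZMod.toCircle (phaseLabel N c).toAdd : ℂ) • (vDE v j 1 * vE v j 1) := by
  obtain ⟨ω, hω, rfl⟩ := h.2 v hv j
  rw [toCircle_phaseLabel]
  exact IsProjRep.mul_eq_commutatorChar_smul hω (1, 0) (0, 1)

theorem unique (hA : IsInjectiveMPS A) (h : HasSPTClass N b U A c)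
    (h' : HasSPTClass N b U A c') : c' = c := by
  have : NeZero D := ⟨hA.bond_pos.ne'⟩
  obtain ⟨v, hv⟩ := h.1
  refine (phaseLabel N).injective (Multiplicative.toAdd.injective (ZMod.injective_toCircle ?_))
  exact Circle.ext (PhaseEq.multiplier_eq (PhaseEq.refl _) (PhaseEq.refl _) (hv.unitary 0 _)
    (hv.unitary 0 _) (h'.vE_mul_vDE hv 0) (h.vE_mul_vDE hv 0))

theorem commutator_eq (h : HasSPTClass N b U A c) {v : ℕ → G N → Matrix (Fin D) (Fin D) ℂ}
    (hv : IsBondUnitaries N b U A v) (j : ℕ) :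
    vE v j 1 * vDE v j 1 * (vE v j 1)ᴴ * (vDE v j 1)ᴴ = phase N (phaseLabel N c).toAdd • 1 := by
  rw [phase_eq_toCircle]
  exact commutator_eq_smul_one (hv.unitary _ _) (hv.unitary _ _) (h.vE_mul_vDE hv j)

/-- Up to phases `v_{e,1} = v_{e,0}^b` and `v_{de,1} = v_{de,0}^b v_{e,0}^b`, so the commutation
phase on the next bond is the `b²`-th power of the one on this bond, and the two are equal. -/
theorem phaseLabel_mul_eq_zero (hA : IsInjectiveMPS A) (h : HasSPTClass N b U A c) :
    (phaseLabel N c).toAdd * ((b : ZMod N) ^ 2 - 1) = 0 := by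
  have : NeZero D := ⟨hA.bond_pos.ne'⟩
  obtain ⟨v, hv⟩ := h.1
  set k := (phaseLabel N c).toAdd
  have hpow := pow_mul_pow_of_mul_eq_smul (h.vE_mul_vDE hv 0) b b
  have hnext : vE v 0 1 ^ b * (vDE v 0 1 ^ b * vE v 0 1 ^ b) =
      (ZMod.toCircle k : ℂ) ^ (b * b) • (vDE v 0 1 ^ b * vE v 0 1 ^ b * vE v 0 1 ^ b) := by
    rw [← Matrix.mul_assoc, hpow, Matrix.smul_mul]
  have hE : vE v 0 1 ∈ Matrix.unitaryGroup (Fin D) ℂ := hv.unitary 0 _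
  have hDE : vDE v 0 1 ∈ Matrix.unitaryGroup (Fin D) ℂ := hv.unitary 0 _
  have hphase : ZMod.toCircle k = ZMod.toCircle k ^ (b * b) := Circle.ext <| by
    rw [Circle.coe_pow]
    exact PhaseEq.multiplier_eq (hv.vE_succ hA 0 1) (hv.vDE_succ' hA 0 1) (pow_mem hE b)
      (mul_mem (pow_mem hDE b) (pow_mem hE b)) (h.vE_mul_vDE hv 1) hnext
  rw [← AddChar.map_nsmul_eq_pow] at hphase
  have hk := ZMod.injective_toCircle hphase
  rw [nsmul_eq_mul, Nat.cast_mul] at hk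
  linear_combination -hk

end HasSPTClass
end Bond

/-! ### Constructing symmetric MPS from bond unitaries -/

section Construct

variable {d D N b L : ℕ} {U : Matrix (Fin d) (Fin d) ℂ} {A : Fin d → Matrix (Fin D) (Fin D) ℂ}

theorem IsBondUnitaries.phaseEq_of_periodic {v : ℕ → G N → Matrix (Fin D) (Fin D) ℂ}
    (hv : IsBondUnitaries N b U A v) (hA : IsInjectiveMPS A)
    (h₁ : WellDefinedOnRing U (expMod b) L) (h₂ : WellDefinedOnRing U (dipExpMod b) L) (g : G N)
    (k : ℕ) : PhaseEq (v (k * L) g) (v 0 g) := by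
  have hg := isBondUnitaries_iff.1 hv g
  induction k with
  | zero => rw [zero_mul]; exact PhaseEq.refl _
  | succ k ih =>
    have hshift : IsPush (fun j => onSite N b U g (j + 1)) A (fun j => v (j + L) g) := by
      simpa only [(onSite_periodic h₁ h₂ g) _] using hg.shift L
    rw [Nat.succ_mul]
    exact (hg.phaseEq hA hshift (k * L)).trans ih

theorem IsBondUnitaries.isSymmetricMPS {v : ℕ → G N → Matrix (Fin D) (Fin D) ℂ}
    (hv : IsBondUnitaries N b U A v) (hA : IsInjectiveMPS A)
    (hU : U ∈ Matrix.unitaryGroup (Fin d) ℂ) (hN : orderOf U = N) (hL : L ≡ 0 [MOD N])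
    (hb : b ^ L ≡ 1 [MOD N]) : IsSymmetricMPS N b L U A := by
  obtain ⟨h₁, h₂⟩ := (wellDefinedOnRing_expMod_and_dipExpMod_iff hU hN).2 ⟨hL, hb⟩
  refine ⟨hU, hN, h₁, h₂, hA, fun g k _ => ?_⟩
  obtain ⟨c, hc⟩ := (isBondUnitaries_iff.1 hv g).exists_prod_act_eq (k * L)
  obtain ⟨c', hc'⟩ := hv.phaseEq_of_periodic hA h₁ h₂ g k
  refine ⟨c * c', funext fun σ => ?_⟩
  rw [symOp_mulVec_mpsState h₁ h₂, hc, hc', Matrix.trace_smul, Matrix.mul_smul, Matrix.trace_smul,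
    Matrix.trace_mul_comm, ← Matrix.mul_assoc, mul_conjTranspose_self_of_mem (hv.unitary 0 g),
    one_mul, smul_smul, ← Circle.coe_mul]
  rfl

/-- The bond unitaries `v_{de,j}(1)` obtained by iterating `v_{de,j} = v_{de,j-1}^b v_{e,j}` from
`v_{e,0}(1) = x` and `v_{de,0}(1) = y`. -/
def dipoleBond (b : ℕ) (x y : Matrix (Fin D) (Fin D) ℂ) : ℕ → Matrix (Fin D) (Fin D) ℂ
  | 0 => y
  | j + 1 => dipoleBond b x y j ^ b * x ^ b ^ (j + 1)

variable {x y : Matrix (Fin D) (Fin D) ℂ}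

theorem PushSite.pow_pow (hx : PushSite U A x (x ^ b)) (j : ℕ) :
    PushSite (U ^ b ^ j) A (x ^ b ^ j) (x ^ b ^ (j + 1)) := by
  simpa only [← pow_mul x, ← pow_succ'] using hx.pow (b ^ j)

theorem PushSite.pow_dipoleBond (hx : PushSite U A x (x ^ b))
    (hy : PushSite U A y (y ^ b * x ^ b)) (j : ℕ) :
    PushSite (U ^ ((j + 1) * b ^ j)) A (dipoleBond b x y j) (dipoleBond b x y (j + 1)) := by
  induction j with
  | zero => simpa [dipoleBond] using hy
  | succ j ih =>
    have hexponent : (j + 1) * b ^ j * b + b ^ (j + 1) = (j + 1 + 1) * b ^ (j + 1) := by ring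
    have hnext := (ih.pow b).mul (hx.pow_pow (j + 1))
    rwa [← pow_mul U, ← pow_add, hexponent] at hnext

theorem dipoleBond_mem_unitaryGroup (hx : x ∈ Matrix.unitaryGroup (Fin D) ℂ)
    (hy : y ∈ Matrix.unitaryGroup (Fin D) ℂ) (b j : ℕ) :
    dipoleBond b x y j ∈ Matrix.unitaryGroup (Fin D) ℂ := by
  induction j with
  | zero => exact hy
  | succ j ih => exact mul_mem (pow_mem ih _) (pow_mem hx _)

theorem isBondUnitaries_dipoleBond (hx : x ∈ Matrix.unitaryGroup (Fin D) ℂ)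
    (hy : y ∈ Matrix.unitaryGroup (Fin D) ℂ) (hUx : PushSite U A x (x ^ b))
    (hUy : PushSite U A y (y ^ b * x ^ b)) : IsBondUnitaries N b U A fun j g =>
      (x ^ b ^ j) ^ g.1.val * dipoleBond b x y j ^ g.2.val := by
  refine isBondUnitaries_iff.2 fun g => ⟨fun j => mul_mem (pow_mem (pow_mem hx _) _)
    (pow_mem (dipoleBond_mem_unitaryGroup hx hy b j) _), fun j => ?_⟩
  rw [onSite_eq_pow, expMod, dipExpMod, Nat.add_sub_cancel, mul_comm, mul_comm g.2.val, pow_add,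
    pow_mul U, pow_mul U]
  exact ((hUx.pow_pow j).pow _).mul ((hUx.pow_dipoleBond hUy j).pow _)

end Construct

/-! ### The clock-and-shift model -/

section Shift

theorem orderOf_permMatrix {m R : Type*} [Fintype m] [DecidableEq m] [Semiring R] [Nontrivial R]
    (σ : Equiv.Perm m) : orderOf (σ.permMatrix R) = orderOf σ := by
  have hinj : Function.Injective (Matrix.permMatrixHom (n := m) (R := R)) := fun σ τ h => by
    refine inv_injective (a₁ := σ) <| Equiv.ext fun i => ?_
    simpa [PEquiv.toMatrix_toPEquiv_apply, Pi.single_apply] using congrFun₂ h.symm i (τ⁻¹ i)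
  rw [← orderOf_inv σ, ← orderOf_injective _ hinj, Matrix.permMatrixHom_apply, inv_inv]

theorem permMatrix_mem_unitaryGroup {m : Type*} [Fintype m] [DecidableEq m] (σ : Equiv.Perm m) :
    σ.permMatrix ℂ ∈ Matrix.unitaryGroup m ℂ := by
  rw [Matrix.mem_unitaryGroup_iff, Matrix.star_eq_conjTranspose, Matrix.conjTranspose_permMatrix,
    ← Matrix.permMatrix_mul, inv_mul_cancel, Matrix.permMatrix_one]

theorem orderOf_addRight {H : Type*} [AddGroup H] (a : H) :
    orderOf (Equiv.addRight a) = addOrderOf a := by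
  refine Nat.dvd_right_iff_eq.1 fun m => ?_
  have hpow : ∀ x, (Equiv.addRight a ^ m) x = x + m • a := fun x => by
    rw [← Equiv.Perm.iterate_eq_pow, Equiv.coe_addRight, add_right_iterate]
  rw [orderOf_dvd_iff_pow_eq_one, addOrderOf_dvd_iff_nsmul_eq_zero]
  refine ⟨fun h => ?_, fun h => Equiv.ext fun x => by rw [hpow, h, add_zero, Equiv.Perm.one_apply]⟩
  rw [← zero_add (m • a), ← hpow, h, Equiv.Perm.one_apply]

/-- The labelling of the basis states of `ℂⁿ` by `ℤ_n`. -/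
def zmodLabel (n : ℕ) [NeZero n] : Fin n ≃ ZMod n := (ZMod.finEquiv n).toEquiv

variable {N : ℕ} [NeZero N]

/-- The permutation `s ↦ s + 1` of the basis labels. -/
def succLabel (N : ℕ) [NeZero N] : Equiv.Perm (Fin N) :=
  (zmodLabel N).symm.permCongr (Equiv.addRight 1)

/-- The operator with `(cyclicShift N · A)^s = A^{s+1}` that generates the symmetry of the
clock-and-shift model. -/
def cyclicShift (N : ℕ) [NeZero N] : Matrix (Fin N) (Fin N) ℂ := (succLabel N).permMatrix ℂ

theorem cyclicShift_mem_unitaryGroup : cyclicShift N ∈ Matrix.unitaryGroup (Fin N) ℂ :=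
  permMatrix_mem_unitaryGroup _

theorem orderOf_cyclicShift : orderOf (cyclicShift N) = N := by
  rw [cyclicShift, orderOf_permMatrix, succLabel]
  exact ((zmodLabel N).symm.permCongrHom.orderOf_eq _).trans
    ((orderOf_addRight _).trans (ZMod.addOrderOf_one N))

theorem act_cyclicShift {D : ℕ} (A : Fin N → Matrix (Fin D) (Fin D) ℂ) (s : Fin N) :
    act (cyclicShift N) A s = A (succLabel N s) := by
  simp [act, cyclicShift]

/-- Reduction modulo `n ∣ N` of a physical label to a bond label. -/
def bondLabel {n : ℕ} (hnN : n ∣ N) (s : Fin N) : ZMod n :=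
  ZMod.castHom hnN (ZMod n) (zmodLabel N s)

theorem bondLabel_succLabel {n : ℕ} (hnN : n ∣ N) (s : Fin N) :
    bondLabel hnN (succLabel N s) = bondLabel hnN s + 1 := by
  simp only [bondLabel, succLabel, Equiv.permCongr_apply, Equiv.symm_symm, Equiv.apply_symm_apply,
    Equiv.coe_addRight, map_add, map_one]

theorem card_mul_sum_comp_of_surjective {H K R : Type*} [AddGroup H] [AddGroup K] [Fintype H]
    [Fintype K] [CommSemiring R] {φ : H →+ K} (hφ : Function.Surjective φ) (f : K → R) :
    (Fintype.card K : R) * ∑ h, f (φ h) = Fintype.card H * ∑ k, f k := by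
  have htranslate : ∀ k, ∑ h, f (φ h + k) = ∑ h, f (φ h) := fun k => by
    obtain ⟨l, rfl⟩ := hφ k
    simpa only [Equiv.coe_addRight, map_add] using
      Equiv.sum_comp (Equiv.addRight l) fun h => f (φ h)
  calc (Fintype.card K : R) * ∑ h, f (φ h) = ∑ k, ∑ h, f (φ h + k) := by
        simp only [htranslate, Finset.sum_const, Finset.card_univ, nsmul_eq_mul]
    _ = ∑ h, ∑ k, f (φ h + k) := Finset.sum_comm
    _ = ∑ _h : H, ∑ k, f k :=
        Finset.sum_congr rfl fun h _ => Equiv.sum_comp (Equiv.addLeft (φ h)) f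
    _ = Fintype.card H * ∑ k, f k := by rw [Finset.sum_const, Finset.card_univ, nsmul_eq_mul]

theorem inv_mul_sum_bondLabel {n : ℕ} [NeZero n] (hnN : n ∣ N) (f : ZMod n → ℂ) :
    (N : ℂ)⁻¹ * ∑ s, f (bondLabel hnN s) = (n : ℂ)⁻¹ * ∑ t, f t := by
  have hsum := card_mul_sum_comp_of_surjective
    (φ := (ZMod.castHom hnN (ZMod n)).toAddMonoidHom) (ZMod.castHom_surjective hnN) f
  have hlabel : ∑ s, f (bondLabel hnN s) = ∑ z, f (ZMod.castHom hnN (ZMod n) z) :=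
    (zmodLabel N).sum_comp fun z => f (ZMod.castHom hnN (ZMod n) z)
  rw [ZMod.card, ZMod.card] at hsum
  rw [inv_mul_eq_iff_eq_mul₀ (NeZero.ne _), mul_left_comm, eq_comm,
    inv_mul_eq_iff_eq_mul₀ (NeZero.ne _), hlabel]
  exact hsum.symm

end Shift

section Clock

variable {n : ℕ} [NeZero n] (χ : AddChar (ZMod n) Circle)

/-- The generalised Pauli matrix `Z^p X^q`, where `Z |a⟩ = χ(a) |a⟩` and `⟨a| X = ⟨a + 1|`. -/
def pauli (p q : ZMod n) : Matrix (Fin n) (Fin n) ℂ := fun a c =>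
  if c = (zmodLabel n).symm (zmodLabel n a + q) then (χ (p * zmodLabel n a) : ℂ) else 0

theorem pauli_mul_apply (p q : ZMod n) (M : Matrix (Fin n) (Fin n) ℂ) (a c : Fin n) :
    (pauli χ p q * M) a c =
      χ (p * zmodLabel n a) * M ((zmodLabel n).symm (zmodLabel n a + q)) c := by
  simp only [Matrix.mul_apply, pauli, ite_mul, zero_mul, Finset.sum_ite_eq',
    Finset.mem_univ, if_true]

theorem pauli_mul_pauli (p q p' q' : ZMod n) :
    pauli χ p q * pauli χ p' q' = (χ (p' * q) : ℂ) • pauli χ (p + p') (q + q') := by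
  ext a c
  have hphase : p * zmodLabel n a + p' * (zmodLabel n a + q) =
      p' * q + (p + p') * zmodLabel n a := by ring
  rw [pauli_mul_apply, Matrix.smul_apply, smul_eq_mul]
  simp only [pauli, Equiv.apply_symm_apply, mul_ite, mul_zero, add_assoc, ← Circle.coe_mul,
    ← AddChar.map_add_eq_mul, hphase]

theorem pauli_zero_zero : pauli χ 0 0 = 1 := by
  ext a c
  simp [pauli, Matrix.one_apply, eq_comm]

theorem phaseEq_pauli_pow (p q : ZMod n) (m : ℕ) :
    PhaseEq (pauli χ p q ^ m) (pauli χ (m * p) (m * q)) := by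
  induction m with
  | zero => rw [pow_zero, Nat.cast_zero, zero_mul, zero_mul, pauli_zero_zero]; exact PhaseEq.refl _
  | succ m ih =>
    rw [pow_succ]
    refine (ih.mul (PhaseEq.refl _)).trans ⟨χ (p * (m * q)), ?_⟩
    rw [pauli_mul_pauli, Nat.cast_succ, add_one_mul, add_one_mul]

theorem pauli_mem_unitaryGroup (p q : ZMod n) : pauli χ p q ∈ Matrix.unitaryGroup (Fin n) ℂ := by
  rw [Matrix.mem_unitaryGroup_iff]
  ext a c
  rw [pauli_mul_apply, Matrix.star_apply, pauli, Matrix.one_apply]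
  by_cases h : a = c
  · simp [h, ← Circle.coe_inv_eq_conj]
  · simp [h]

theorem pauli_mul_pauli_comm (q : ZMod n) : pauli χ (-1) q * pauli χ (-1) 0 =
    (χ (-q) : ℂ) • (pauli χ (-1) 0 * pauli χ (-1) q) := by
  rw [pauli_mul_pauli, pauli_mul_pauli, smul_smul, mul_zero, AddChar.map_zero_eq_one,
    Circle.coe_one, mul_one, neg_one_mul, add_zero, zero_add]

theorem sum_addChar_mul {χ : AddChar (ZMod n) Circle} (hχ : χ.IsPrimitive) (z : ZMod n) :
    ∑ t, (χ (t * z) : ℂ) = if z = 0 then (n : ℂ) else 0 := by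
  have hsum := AddChar.sum_mulShift z
    (hχ.compMulHom_of_isPrimitive (f := Circle.coeHom) Circle.coe_injective)
  rwa [ZMod.card, Nat.cast_ite, Nat.cast_zero] at hsum

variable {N : ℕ} [NeZero N] (hnN : n ∣ N) (b : ℕ)

/-- The cluster-state tensor `A^s = N^{-1/2} χ(as - bs²) |a⟩⟨s|`, with the physical label `s`
reduced modulo `n` in the bond indices. -/
def clusterTensor (s : Fin N) : Matrix (Fin n) (Fin n) ℂ := fun a c =>
  if c = (zmodLabel n).symm (bondLabel hnN s) then
    ((√(N : ℝ) : ℝ) : ℂ)⁻¹ * χ (zmodLabel n a * bondLabel hnN s - b * bondLabel hnN s ^ 2)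
  else 0

theorem clusterTensor_mul_apply (s : Fin N) (M : Matrix (Fin n) (Fin n) ℂ) (a c : Fin n) :
    (clusterTensor χ hnN b s * M) a c =
      ((√(N : ℝ) : ℝ) : ℂ)⁻¹ * χ (zmodLabel n a * bondLabel hnN s - b * bondLabel hnN s ^ 2) *
        M ((zmodLabel n).symm (bondLabel hnN s)) c := by
  simp only [Matrix.mul_apply, clusterTensor, ite_mul, zero_mul, Finset.sum_ite_eq',
    Finset.mem_univ, if_true]

theorem pauli_mul_clusterTensor_succLabel (q : ZMod n) (s : Fin N) :
    pauli χ (-1) q * clusterTensor χ hnN b (succLabel N s) =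
      (χ (q - b) : ℂ) • (clusterTensor χ hnN b s * pauli χ (q - 2 * b) 1) := by
  ext a c
  have hphase : -1 * zmodLabel n a + ((zmodLabel n a + q) * (bondLabel hnN s + 1) -
      b * (bondLabel hnN s + 1) ^ 2) = q - b + (zmodLabel n a * bondLabel hnN s -
      b * bondLabel hnN s ^ 2 + (q - 2 * b) * bondLabel hnN s) := by ring
  rw [Matrix.smul_apply, smul_eq_mul, pauli_mul_apply, clusterTensor_mul_apply]
  simp only [pauli, clusterTensor, Equiv.apply_symm_apply, bondLabel_succLabel, mul_ite, mul_zero]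
  congr 1
  rw [mul_left_comm, mul_assoc, mul_left_comm (χ (q - b) : ℂ)]
  simp only [← Circle.coe_mul, ← AddChar.map_add_eq_mul, hphase]

theorem pushSite_clusterTensor (q : ZMod n) :
    PushSite (cyclicShift N) (clusterTensor χ hnN b) (pauli χ (-1) q) (pauli χ (q - 2 * b) 1) :=
  PushSite.of_mul_eq (pauli_mem_unitaryGroup χ _ _) (χ (q - b)) fun s => by
    rw [act_cyclicShift, pauli_mul_clusterTensor_succLabel]

variable {b}

theorem pushSite_clusterTensor_exp (hb : (b : ZMod n) ^ 2 = 1) :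
    PushSite (cyclicShift N) (clusterTensor χ hnN b) (pauli χ (-1) b) (pauli χ (-1) b ^ b) := by
  refine (pushSite_clusterTensor χ hnN b b).congr_right ?_
  have hpow := phaseEq_pauli_pow χ (-1) (b : ZMod n) b
  rw [← pow_two, hb, mul_neg_one] at hpow
  convert hpow.symm using 2
  ring

theorem pushSite_clusterTensor_dipExp (hb : (b : ZMod n) ^ 2 = 1) :
    PushSite (cyclicShift N) (clusterTensor χ hnN b) (pauli χ (-1) 0)
      (pauli χ (-1) 0 ^ b * pauli χ (-1) b ^ b) := by
  refine (pushSite_clusterTensor χ hnN b 0).congr_right ?_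
  have hpow := (phaseEq_pauli_pow χ (-1) 0 b).mul (phaseEq_pauli_pow χ (-1) (b : ZMod n) b)
  rw [← pow_two, hb, mul_neg_one, mul_zero, pauli_mul_pauli, zero_add] at hpow
  convert (hpow.trans ⟨_, rfl⟩).symm using 2
  ring

theorem star_clusterTensor_mul (s : Fin N) (a a' c c' : Fin n) :
    star (clusterTensor χ hnN b s a c) * clusterTensor χ hnN b s a' c' =
      if c = (zmodLabel n).symm (bondLabel hnN s) then
        if c' = (zmodLabel n).symm (bondLabel hnN s) then
          (N : ℂ)⁻¹ * χ (bondLabel hnN s * (zmodLabel n a' - zmodLabel n a)) else 0 else 0 := by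
  have hnorm : star ((√(N : ℝ) : ℝ) : ℂ)⁻¹ * ((√(N : ℝ) : ℝ) : ℂ)⁻¹ = (N : ℂ)⁻¹ := by
    rw [star_inv₀, Complex.star_def, Complex.conj_ofReal, ← mul_inv, ← Complex.ofReal_mul,
      Real.mul_self_sqrt (Nat.cast_nonneg N), Complex.ofReal_natCast]
  have hstar : ∀ t, star (χ t : ℂ) = χ (-t) := fun t => by
    rw [AddChar.map_neg_eq_inv, Circle.coe_inv_eq_conj, Complex.star_def]
  unfold clusterTensor
  split_ifs
  · rw [star_mul', mul_mul_mul_comm, hnorm, hstar, ← Circle.coe_mul, ← AddChar.map_add_eq_mul]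
    congr 3
    ring
  all_goals simp only [star_zero, zero_mul, mul_zero]

theorem conjTranspose_clusterTensor_mul_mul (X : Matrix (Fin n) (Fin n) ℂ) (s : Fin N)
    (c c' : Fin n) :
    ((clusterTensor χ hnN b s)ᴴ * X * clusterTensor χ hnN b s) c c' = (N : ℂ)⁻¹ *
      if c = (zmodLabel n).symm (bondLabel hnN s) then
        if c' = (zmodLabel n).symm (bondLabel hnN s) then
          ∑ a, ∑ a', X a a' * χ (bondLabel hnN s * (zmodLabel n a' - zmodLabel n a))
        else 0 else 0 := by
  simp only [Matrix.mul_apply, Matrix.conjTranspose_apply, Finset.sum_mul]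
  rw [Finset.sum_comm]
  simp only [mul_right_comm _ (X _ _), star_clusterTensor_mul]
  split_ifs
  · simp only [Finset.mul_sum, mul_assoc, mul_comm (X _ _)]
  all_goals simp only [zero_mul, mul_zero, Finset.sum_const_zero]

theorem transfer_clusterTensor (X : Matrix (Fin n) (Fin n) ℂ) :
    transfer (clusterTensor χ hnN b) X = Matrix.diagonal fun c =>
      (n : ℂ)⁻¹ * ∑ a, ∑ a', X a a' * χ (zmodLabel n c * (zmodLabel n a' - zmodLabel n a)) := by
  ext c c'
  simp only [transfer, Matrix.sum_apply, conjTranspose_clusterTensor_mul_mul]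
  rw [← Finset.mul_sum, inv_mul_sum_bondLabel hnN fun t =>
    if c = (zmodLabel n).symm t then if c' = (zmodLabel n).symm t then
      ∑ a, ∑ a', X a a' * (χ (t * (zmodLabel n a' - zmodLabel n a)) : ℂ) else 0 else 0]
  simp only [Equiv.eq_symm_apply, Finset.sum_ite_eq, Finset.mem_univ, if_true,
    Matrix.diagonal_apply, mul_ite, mul_zero, EmbeddingLike.apply_eq_iff_eq, @eq_comm _ c c']

theorem transfer_clusterTensor_of_isDiag {X : Matrix (Fin n) (Fin n) ℂ} (hX : X.IsDiag) :
    transfer (clusterTensor χ hnN b) X = ((n : ℂ)⁻¹ * X.trace) • 1 := by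
  rw [transfer_clusterTensor, Matrix.smul_one_eq_diagonal]
  congr! 3 with c
  refine Finset.sum_congr rfl fun a _ => ?_
  rw [Finset.sum_eq_single a (fun a' _ ha => by rw [hX ha.symm, zero_mul])
    fun ha => absurd (Finset.mem_univ a) ha]
  simp

theorem clusterTensor_left_canonical :
    ∑ s, (clusterTensor χ hnN b s)ᴴ * clusterTensor χ hnN b s = 1 := by
  have h := transfer_clusterTensor_of_isDiag χ hnN (b := b) Matrix.isDiag_one
  simpa [transfer, NeZero.ne] using h

variable {χ}

theorem clusterTensor_right_canonical (hχ : χ.IsPrimitive) :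
    ∑ s, clusterTensor χ hnN b s * (clusterTensor χ hnN b s)ᴴ = 1 := by
  ext a a'
  have hentry : ∀ s, (clusterTensor χ hnN b s * (clusterTensor χ hnN b s)ᴴ) a a' =
      (N : ℂ)⁻¹ * χ (bondLabel hnN s * (zmodLabel n a - zmodLabel n a')) := fun s => by
    simp only [Matrix.mul_apply, Matrix.conjTranspose_apply,
      mul_comm (clusterTensor χ hnN b s a _), star_clusterTensor_mul, Finset.sum_ite_eq',
      Finset.mem_univ, if_true]
  simp only [Matrix.sum_apply, hentry]
  rw [← Finset.mul_sum, inv_mul_sum_bondLabel hnN fun t =>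
    (χ (t * (zmodLabel n a - zmodLabel n a')) : ℂ), sum_addChar_mul hχ, Matrix.one_apply]
  simp [sub_eq_zero]

/-- The transfer matrix has rank one: an eigenvector with nonzero eigenvalue is diagonal, and the
transfer matrix sends a diagonal matrix to its normalised trace. -/
theorem eq_one_of_transfer_clusterTensor_eq_smul {μ : ℂ} (hμ : μ ≠ 0)
    {X : Matrix (Fin n) (Fin n) ℂ} (hX : X ≠ 0)
    (h : transfer (clusterTensor χ hnN b) X = μ • X) : μ = 1 ∧ ∃ a : ℂ, X = a • 1 := by
  have hdiag : X.IsDiag := by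
    have hsmul : (μ • X).IsDiag := by
      rw [← h, transfer_clusterTensor]
      exact Matrix.isDiag_diagonal _
    simpa only [smul_smul, inv_mul_cancel₀ hμ, one_smul] using hsmul.smul μ⁻¹
  rw [transfer_clusterTensor_of_isDiag χ hnN hdiag] at h
  have hX' : X = (μ⁻¹ * ((n : ℂ)⁻¹ * X.trace)) • 1 := by
    rw [mul_smul, h, smul_smul, inv_mul_cancel₀ hμ, one_smul]
  have htrace : X.trace ≠ 0 := fun h₀ => hX <| by
    rw [hX', h₀, mul_zero, mul_zero, zero_smul]
  refine ⟨?_, _, hX'⟩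
  have htr := congrArg Matrix.trace h
  rw [Matrix.trace_smul, Matrix.trace_smul, Matrix.trace_one, Fintype.card_fin, smul_eq_mul,
    smul_eq_mul, mul_right_comm, inv_mul_cancel₀ (NeZero.ne _)] at htr
  exact (mul_right_cancel₀ htrace htr).symm

theorem isInjectiveMPS_clusterTensor (hχ : χ.IsPrimitive) :
    IsInjectiveMPS (clusterTensor χ hnN b) where
  bond_pos := NeZero.pos n
  left_canonical := clusterTensor_left_canonical χ hnN
  right_canonical := ⟨1, Matrix.PosDef.one, by
    simpa only [mul_one] using clusterTensor_right_canonical hnN hχ⟩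
  gap μ X hX h := by
    rcases eq_or_ne μ 0 with rfl | hμ
    · exact .inl (by rw [norm_zero]; exact one_pos)
    · exact .inr (eq_one_of_transfer_clusterTensor_eq_smul hnN hμ hX h)

end Clock

/-! ### The realised classes -/

section Classification

variable {N : ℕ} [NeZero N] {b L : ℕ}

/-- `χ` is the character of the subgroup generated by `exp(-2πi bk/N)`, whose order divides `N` and
`b² - 1`. -/
theorem exists_isPrimitive_addChar {k : ZMod N} (hk : k * ((b : ZMod N) ^ 2 - 1) = 0) :
    ∃ (n : ℕ) (_ : NeZero n) (_ : n ∣ N) (χ : AddChar (ZMod n) Circle),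
      χ.IsPrimitive ∧ (b : ZMod n) ^ 2 = 1 ∧ χ (-b) = ZMod.toCircle k := by
  have hkb : k * (b : ZMod N) ^ 2 = k := by rwa [mul_sub, mul_one, sub_eq_zero] at hk
  set ζ := ZMod.toCircle (-(b * k) : ZMod N)
  have hpow : ∀ m : ℕ, ζ ^ m = ZMod.toCircle (m * -(b * k) : ZMod N) := fun m => by
    rw [← AddChar.map_nsmul_eq_pow, nsmul_eq_mul]
  have hdvd : orderOf ζ ∣ N := orderOf_dvd_of_pow_eq_one <| by
    rw [hpow, CharP.cast_eq_zero, zero_mul, AddChar.map_zero_eq_one]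
  have hne : NeZero (orderOf ζ) := ⟨ne_zero_of_dvd_ne_zero (NeZero.ne N) hdvd⟩
  refine ⟨orderOf ζ, hne, hdvd, _,
    AddChar.zmodChar_primitive_of_primitive_root _ (IsPrimitiveRoot.orderOf ζ), ?_, ?_⟩
  · have hsq : ζ ^ b ^ 2 = ζ ^ 1 := by
      rw [hpow, hpow, Nat.cast_pow, Nat.cast_one, one_mul, mul_neg, mul_left_comm, mul_comm _ k,
        hkb]
    simpa using (ZMod.natCast_eq_natCast_iff _ _ _).2 (pow_eq_pow_iff_modEq.1 hsq)
  · rw [AddChar.map_neg_eq_inv, AddChar.zmodChar_apply', hpow, ← AddChar.map_neg_eq_inv,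
      mul_neg, neg_neg, ← mul_assoc, ← pow_two, mul_comm, hkb]

theorem isBondUnitaries_clusterTensor {n : ℕ} [NeZero n] (hnN : n ∣ N)
    (χ : AddChar (ZMod n) Circle) (hb : (b : ZMod n) ^ 2 = 1) :
    IsBondUnitaries N b (cyclicShift N) (clusterTensor χ hnN b) fun j g =>
      (pauli χ (-1) b ^ b ^ j) ^ g.1.val *
        dipoleBond b (pauli χ (-1) b) (pauli χ (-1) 0) j ^ g.2.val :=
  isBondUnitaries_dipoleBond (pauli_mem_unitaryGroup _ _ _) (pauli_mem_unitaryGroup _ _ _)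
    (pushSite_clusterTensor_exp χ hnN hb) (pushSite_clusterTensor_dipExp χ hnN hb)

theorem HasSPTClass.phaseLabel_clusterTensor {n : ℕ} [NeZero n] {hnN : n ∣ N}
    {χ : AddChar (ZMod n) Circle} (hb : (b : ZMod n) ^ 2 = 1) {k : ZMod N}
    (hχ : χ (-b) = ZMod.toCircle k) {c : H2 (G N)}
    (hc : HasSPTClass N b (cyclicShift N) (clusterTensor χ hnN b) c) :
    (phaseLabel N c).toAdd = k := by
  obtain rfl | hN := eq_or_ne N 1
  · exact Subsingleton.elim _ _
  have hval : (1 : ZMod N).val = 1 := ZMod.val_one'' hN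
  have hcomm := hc.vE_mul_vDE (isBondUnitaries_clusterTensor hnN χ hb) 0
  simp only [vE, vDE, hval, ZMod.val_zero, pow_zero, pow_one, mul_one, one_mul, dipoleBond,
    pauli_mul_pauli_comm, hχ] at hcomm
  have hphase := smul_left_injective_of_mem_unitaryGroup
    (mul_mem (pauli_mem_unitaryGroup χ (-1) 0) (pauli_mem_unitaryGroup χ (-1) (b : ZMod n))) hcomm
  exact (ZMod.injective_toCircle (Circle.ext hphase)).symm

theorem isSPTClass_of_phaseLabel_mul_eq_zero (hL : 1 ≤ L) (hLN : L ≡ 0 [MOD N])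
    (hbL : b ^ L ≡ 1 [MOD N]) {c : H2 (G N)}
    (hc : (phaseLabel N c).toAdd * ((b : ZMod N) ^ 2 - 1) = 0) : IsSPTClass N b L c := by
  obtain ⟨n, _, hnN, χ, hχ, hb, hχb⟩ := exists_isPrimitive_addChar hc
  have hsymm := (isBondUnitaries_clusterTensor hnN χ hb).isSymmetricMPS
    (isInjectiveMPS_clusterTensor hnN hχ) cyclicShift_mem_unitaryGroup orderOf_cyclicShift hLN hbL
  obtain ⟨c', hc'⟩ := hsymm.exists_hasSPTClass hL
  obtain rfl : c' = c := (phaseLabel N).injective (hc'.phaseLabel_clusterTensor hb hχb)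
  exact ⟨N, n, cyclicShift N, clusterTensor χ hnN b, hsymm, hc'⟩

theorem isSPTClass_iff (hL : 1 ≤ L) (hLN : L ≡ 0 [MOD N]) (hbL : b ^ L ≡ 1 [MOD N])
    (c : H2 (G N)) :
    IsSPTClass N b L c ↔ (phaseLabel N c).toAdd * ((b : ZMod N) ^ 2 - 1) = 0 := by
  refine ⟨?_, isSPTClass_of_phaseLabel_mul_eq_zero hL hLN hbL⟩
  rintro ⟨d, D, U, A, hA, hc⟩
  exact hc.phaseLabel_mul_eq_zero hA.injective

theorem exists_subgroup_isSPTClass (hb : 1 ≤ b) (hL : 1 ≤ L) (hLN : L ≡ 0 [MOD N])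
    (hbL : b ^ L ≡ 1 [MOD N]) : ∃ P : Subgroup (H2 (G N)), (∀ c, c ∈ P ↔ IsSPTClass N b L c) ∧
      Nonempty (P ≃* Multiplicative (ZMod (Nat.gcd (b ^ 2 - 1) N))) := by
  obtain ⟨P, hP, hPN⟩ := exists_torsion_subgroup (phaseLabel N) (b ^ 2 - 1)
  refine ⟨P, fun c => ?_, hPN⟩
  rw [hP, isSPTClass_iff hL hLN hbL, Nat.cast_sub (Nat.one_le_pow _ _ hb), Nat.cast_pow,
    Nat.cast_one]

end Classification

end TiltedExp

end

theorem mainTheorem11 (N b L : ℕ) (hN : 1 ≤ N) (hb : 1 ≤ b) (hL : 1 ≤ L) :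
    -- periodicity
    (∀ (d : ℕ) (U : Matrix (Fin d) (Fin d) ℂ), U ∈ Matrix.unitaryGroup (Fin d) ℂ →
      orderOf U = N →
      ((TiltedExp.WellDefinedOnRing U (TiltedExp.expMod b) L ∧
          TiltedExp.WellDefinedOnRing U (TiltedExp.dipExpMod b) L) ↔
        (L ≡ 0 [MOD N] ∧ b ^ L ≡ 1 [MOD N]))) ∧
    (L ≡ 0 [MOD N] → b ^ L ≡ 1 [MOD N] → Nat.Coprime b N) ∧
    (Nat.Coprime b N → ∀ k : ℕ, k * Nat.totient N * N ≡ 0 [MOD N] ∧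
      b ^ (k * Nat.totient N * N) ≡ 1 [MOD N]) ∧
    -- the class in `H²(ℤ_N × ℤ_N, U(1)) ≅ ℤ_N` is read off from the commutator phase
    ∃ κ : TiltedExp.H2 (TiltedExp.G N) ≃* Multiplicative (ZMod N),
      (∀ ω : TiltedExp.Z2 (TiltedExp.G N),
        (ω.1 (1, 0) (0, 1) : ℂ) / (ω.1 (0, 1) (1, 0) : ℂ) =
          TiltedExp.phase N (κ (TiltedExp.H2.mk ω)).toAdd) ∧
      -- bond unitaries of a symmetric MPS
      (∀ (d D : ℕ) (U : Matrix (Fin d) (Fin d) ℂ) (A : Fin d → Matrix (Fin D) (Fin D) ℂ),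
        TiltedExp.IsSymmetricMPS N b L U A →
        (∃ v, TiltedExp.IsBondUnitaries N b U A v) ∧
        (∀ v, TiltedExp.IsBondUnitaries N b U A v → ∀ (j : ℕ) (g : ZMod N),
          TiltedExp.PhaseEq (TiltedExp.vE v (j + 1) g) (TiltedExp.vE v j g ^ b) ∧
          TiltedExp.PhaseEq (TiltedExp.vDE v (j + 1) g)
            (TiltedExp.vDE v j g ^ b * TiltedExp.vE v (j + 1) g) ∧
          TiltedExp.PhaseEq (TiltedExp.vDE v (j + 1) g)
            (TiltedExp.vDE v j g ^ b * TiltedExp.vE v j g ^ b)) ∧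
        ∃ c : TiltedExp.H2 (TiltedExp.G N), TiltedExp.HasSPTClass N b U A c ∧
          (∀ c', TiltedExp.HasSPTClass N b U A c' → c' = c) ∧
          (∀ v, TiltedExp.IsBondUnitaries N b U A v → ∀ j : ℕ,
            TiltedExp.vE v j 1 * TiltedExp.vDE v j 1 * (TiltedExp.vE v j 1)ᴴ *
                (TiltedExp.vDE v j 1)ᴴ =
              TiltedExp.phase N (κ c).toAdd • (1 : Matrix (Fin D) (Fin D) ℂ)) ∧
          (κ c).toAdd * ((b : ZMod N) ^ 2 - 1) = 0) ∧
      -- classification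
      (L ≡ 0 [MOD N] → b ^ L ≡ 1 [MOD N] →
        (∀ c : TiltedExp.H2 (TiltedExp.G N), TiltedExp.IsSPTClass N b L c ↔
          (κ c).toAdd * ((b : ZMod N) ^ 2 - 1) = 0) ∧
        ∃ P : Subgroup (TiltedExp.H2 (TiltedExp.G N)),
          (∀ c, c ∈ P ↔ TiltedExp.IsSPTClass N b L c) ∧
          Nonempty (P ≃* Multiplicative (ZMod (Nat.gcd (b ^ 2 - 1) N)))) := by
  have : NeZero N := ⟨by lia⟩
  refine ⟨fun d U => TiltedExp.wellDefinedOnRing_expMod_and_dipExpMod_iff,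
    fun _ => TiltedExp.coprime_of_pow_modEq_one (by lia),
    fun h k => ⟨Nat.modEq_zero_iff_dvd.2 (dvd_mul_left _ _),
      TiltedExp.pow_mul_totient_mul_modEq_one h k N⟩,
    TiltedExp.phaseLabel N, TiltedExp.div_eq_phase_phaseLabel, fun d D U A hA => ?_,
    fun hLN hbL => ⟨TiltedExp.isSPTClass_iff hL hLN hbL,
      TiltedExp.exists_subgroup_isSPTClass hb hL hLN hbL⟩⟩
  obtain ⟨c, hc⟩ := hA.exists_hasSPTClass hL
  exact ⟨hc.1, fun v hv j g => ⟨hv.vE_succ hA.injective j g, hv.vDE_succ hA.injective j g,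
      hv.vDE_succ' hA.injective j g⟩,
    c, hc, fun c' hc' => hc.unique hA.injective hc', fun v hv j => hc.commutator_eq hv j,
    hc.phaseLabel_mul_eq_zero hA.injective⟩
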